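/- **Notation.** A $k$-uniform hypergraph $H=(V,E)$ consists of a finite set $V$ and a set $E$ of $k$-element subsets of $V$; $\delta_2(H)$ is the minimum, over all pairs $S\subseteq V$ of distinct vertices, of the number of edges containing $S$. For a $4$-uniform $H$, the link $H_{uv}$ is the graph on $V$ with edge set $\{xy : uvxy\in E\}$, and $\overline H_v$ is the $3$-uniform hypergraph on $V\setminus\{v\}$ with edge set $\{xyz : vxyz\in E\}$. A path in $H$ is a sequence of distinct vertices any four consecutive ones of which form an edge; an $abc$-$xyz$-path starts with $a,b,c$ and ends with $x,y,z$, and the remaining vertices are its inner vertices. A graph $R$ is $(\beta,\ell)$-robust if any two distinct vertices of $R$ are joined by at least $\beta|V(R)|^{\ell-1}$ paths of length $\ell$ in $R$. **Setup.** Let $\alpha\in(0,1/3)$, let $\beta>0$ and let $\ell\ge 3$ be an odd integer. An $(\alpha,\beta,\ell)$-setup consists of a $4$-uniform hypergraph $H=(V,E)$ with $|V|=n$ and $\delta_2(H)\ge(\frac59+\alpha)\frac{n^2}{2}$ and, for every unordered pair $uv$ of distinct vertices, a $(\beta,\ell)$-robust induced subgraph $R_{uv}\subseteq H_{uv}$ such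 that 1. $|V(R_{uv})|\ge(\frac23+\frac\alpha2)n$, 2. at most $\frac{\alpha^3}{18}n^2$ edges of $H_{uv}$ have one end in $V(R_{uv})$ and the other one in $V\setminus V(R_{uv})$, 3. $e(R_{uv})\ge(\frac59+\frac\alpha2)\frac{n^2}2-\frac{(n-|V(R_{uv})|)^2}{2}\ge(\frac49+\frac23\alpha)\frac{n^2}{2}$. Let $\zeta>0$. A pair $xy$ of distinct vertices of $\overline H_v$ is $\zeta$-connectable in $\overline H_v$ if $xy\in E(R_{uv})$ for at least $\zeta|V(\overline H_v)|$ vertices $u$ of $\overline H_v$. A triple $(x,y,z)$ is a $\zeta$-bridge in $\overline H_v$ if $xyz$ is an edge of $\overline H_v$ and both $xy$ and $yz$ are $\zeta$-connectable in $\overline H_v$. A triple $(x,y,z)\in V^3$ is $\zeta$-connectable in $H$ if it is a $\zeta$-bridge in $\overline H_v$ for at least $\zeta|V|$ vertices $v\in V$. **Connecting constants.** Let $\ell_1,\ell_2,\ell_3,\ell_4\le 50\ell$ be natural numbers with $\ell_i\equiv i\pmod 4$. A number $\theta\in(0,1]$ is a *connecting constant* for $\zeta$ and $(\ell_1,\dots,\ell_4)$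 if there is an $n_0$ such that in every $(\alpha,\beta,\ell)$-setup with $|V|\ge n_0$, for any two disjoint $\zeta$-connectable triples $(a,b,c)$, $(x,y,z)$ and every $i\in[4]$, there are at least $\theta|V|^{\ell_i}$ $abc$-$xyz$-paths in $H$ with $\ell_i$ inner vertices. **Proposition (Reservoir lemma).** Let $\alpha\in(0,1/3)$, $\beta>0$, and let $\ell\ge3$ be odd. There exist natural numbers $\ell_1,\dots,\ell_4\le 50\ell$ with $\ell_i\equiv i\pmod 4$ such that every $\zeta>0$ has a connecting constant for $(\ell_1,\dots,\ell_4)$. Moreover, for all natural numbers $\ell_1,\dots,\ell_4\le50\ell$ with $\ell_i\equiv i\pmod 4$, all $\zeta_\star,\zeta_{\star\star}>0$, and all connecting constants $\theta_\star$ for $\zeta_\star$ and $\theta_{\star\star}$ for $\zeta_{\star\star}$ (both with respect to $(\ell_1,\dots,\ell_4)$) there is an $n_0$ such that in every $(\alpha,\beta,\ell)$-setup with $|V|\ge n_0$ there exists a set $\mathcal R\subseteq V$ such that (i) $\theta_\star^2|V|/2\le|\mathcal R|\le\theta_\star^2|V|$, and (ii) for all disjoint $\zeta_{\star\star}$-connectable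 triples $(a,b,c)$, $(x,y,z)$ in $H$ and every $i\in[4]$, there are at least $\theta_{\star\star}|\mathcal R|^{\ell_i}/2$ $abc$-$xyz$-paths in $H$ with $\ell_i$ inner vertices, all of which belong to $\mathcal R$. -/

import Mathlib

open Finset

universe u

/-- A `k`-uniform hypergraph: a finite vertex set together with a collection of `k`-element
subsets of it.  All vertices are taken from an ambient type `V`. -/
structure UniformHypergraph (V : Type u) (k : ℕ) where
  verts : Finset V
  edges : Finset (Finset V)
  subset_verts : ∀ e ∈ edges, e ⊆ verts
  card_eq : ∀ e ∈ edges, #e = k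

namespace UniformHypergraph

variable {V : Type u} [DecidableEq V] {k : ℕ}

/-- The number of vertices, as a real number. -/
def order (H : UniformHypergraph V k) : ℝ := (#H.verts : ℝ)

/-- The degree of a set `S`: the number of edges containing `S`. -/
def degree (H : UniformHypergraph V k) (S : Finset V) : ℕ := #{e ∈ H.edges | S ⊆ e}

/-- The minimum `j`-degree: the least degree of a `j`-element set of vertices. -/
noncomputable def minDegree (H : UniformHypergraph V k) (j : ℕ) : ℕ :=
  sInf (H.degree '' {S | S ⊆ H.verts ∧ #S = j})

/-- The link of a vertex `v`, on the same vertex set: the `k`-uniform hypergraph whose edges are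
the sets `e` with `v ∉ e` for which `{v} ∪ e` is an edge of `H`. -/
def link (H : UniformHypergraph V (k + 1)) (v : V) : UniformHypergraph V k where
  verts := H.verts
  edges := {e ∈ H.edges | v ∈ e}.image (fun e => e.erase v)
  subset_verts := by
    intro e he
    obtain ⟨f, hf, rfl⟩ := Finset.mem_image.1 he
    exact (Finset.erase_subset _ _).trans (H.subset_verts f (Finset.mem_filter.1 hf).1)
  card_eq := by
    intro e he
    obtain ⟨f, hf, rfl⟩ := Finset.mem_image.1 he
    obtain ⟨h1, h2⟩ := Finset.mem_filter.1 hf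
    rw [Finset.card_erase_of_mem h2, H.card_eq f h1, Nat.add_sub_cancel]

/-- Deletion of a vertex `v` (with all edges containing it). -/
def deleteVert (H : UniformHypergraph V k) (v : V) : UniformHypergraph V k where
  verts := H.verts.erase v
  edges := {e ∈ H.edges | v ∉ e}
  subset_verts := by
    intro e he
    obtain ⟨h1, h2⟩ := Finset.mem_filter.1 he
    exact Finset.subset_erase.2 ⟨H.subset_verts e h1, h2⟩
  card_eq := fun e he => H.card_eq e (Finset.mem_filter.1 he).1

/-- The hypergraph `H_v - v`. -/
def reducedLink (H : UniformHypergraph V (k + 1)) (v : V) : UniformHypergraph V k :=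
  (H.link v).deleteVert v

theorem mem_edges_reducedLink (H : UniformHypergraph V (k + 1)) (v : V) (e : Finset V) :
    e ∈ (H.reducedLink v).edges ↔ v ∉ e ∧ insert v e ∈ H.edges := by
  simp only [reducedLink, link, deleteVert, Finset.mem_filter, Finset.mem_image]
  constructor
  · rintro ⟨⟨f, ⟨hf, hv⟩, rfl⟩, h⟩
    exact ⟨h, by rwa [Finset.insert_erase hv]⟩
  · rintro ⟨h, he⟩
    exact ⟨⟨insert v e, ⟨he, Finset.mem_insert_self _ _⟩, Finset.erase_insert h⟩, h⟩

/-- The link graph `H_{uv}` of the unordered pair `p = uv` in a `4`-uniform hypergraph: `xy` is an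
edge if and only if `uvxy` is an edge of `H`. -/
def pairLink (H : UniformHypergraph V 4) (p : Sym2 V) : SimpleGraph V where
  Adj x y := p.toFinset ∪ {x, y} ∈ H.edges
  symm := ⟨fun x y h => by rwa [Finset.pair_comm y x]⟩
  loopless := ⟨fun x h => by
    have h4 := H.card_eq _ h
    have h1 := Finset.card_union_le p.toFinset {x, x}
    have h2 : #p.toFinset ≤ 2 := by
      rw [Sym2.card_toFinset]; split_ifs <;> omega
    have h3 : #({x, x} : Finset V) = 1 := by simp
    omega⟩

theorem pairLink_adj (H : UniformHypergraph V 4) (u v x y : V) :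
    (H.pairLink s(u, v)).Adj x y ↔ ({u, v, x, y} : Finset V) ∈ H.edges := by
  have : (s(u, v)).toFinset ∪ {x, y} = ({u, v, x, y} : Finset V) := by
    ext w; simp only [Finset.mem_union, Sym2.mem_toFinset, Sym2.mem_iff, Finset.mem_insert,
      Finset.mem_singleton, or_assoc]
  rw [← this]; rfl

/-- A list of vertices is a (tight) path if its entries are distinct vertices of `H` and any `k`
consecutive entries form an edge of `H`. -/
def IsPath (H : UniformHypergraph V k) (l : List V) : Prop :=
  l.Nodup ∧ (∀ v ∈ l, v ∈ H.verts) ∧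
    ∀ t : List V, t <:+: l → t.length = k → t.toFinset ∈ H.edges

/-- The `abc`-`xyz`-paths in `H` with `m` inner vertices, each of them given by the sequence of its
inner vertices. -/
def connectingPaths (H : UniformHypergraph V 4) (a b c x y z : V) (m : ℕ) : Set (List V) :=
  {q | q.length = m ∧ H.IsPath ([a, b, c] ++ q ++ [x, y, z])}

/-- Given a graph `E w` for every vertex `w` of the `3`-uniform hypergraph `G` (only the edges of
these graphs matter here), the pair `xy` of distinct vertices is `ζ`-connectable if it is an edge
of `E w` for at least `ζ |V(G)|` vertices `w`. -/
def IsConnectablePair (G : UniformHypergraph V 3) (E : V → SimpleGraph V) (ζ : ℝ) (x y : V) :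
    Prop :=
  x ∈ G.verts ∧ y ∈ G.verts ∧ x ≠ y ∧
    ζ * G.order ≤ ({w | w ∈ G.verts ∧ (E w).Adj x y}.ncard : ℝ)

/-- The triple `(x, y, z)` is a `ζ`-bridge in the `3`-uniform hypergraph `G`. -/
def IsBridge (G : UniformHypergraph V 3) (E : V → SimpleGraph V) (ζ : ℝ) (x y z : V) : Prop :=
  ({x, y, z} : Finset V) ∈ G.edges ∧ G.IsConnectablePair E ζ x y ∧ G.IsConnectablePair E ζ y z

/-- The triple `(x, y, z)` is `ζ`-connectable in the `4`-uniform hypergraph `H` with respect to the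
family `R` of subgraphs of its pair links: for at least `ζ |V(H)|` vertices `v` it is a `ζ`-bridge
in `H_v - v`, where the graph assigned to a vertex `w` of `H_v - v` is `R_{wv}`. -/
def IsConnectableTriple (H : UniformHypergraph V 4) (R : ∀ p : Sym2 V, (H.pairLink p).Subgraph)
    (ζ : ℝ) (x y z : V) : Prop :=
  x ∈ H.verts ∧ y ∈ H.verts ∧ z ∈ H.verts ∧
    ζ * H.order ≤ ({v | v ∈ H.verts ∧
      (H.reducedLink v).IsBridge (fun w => (R s(w, v)).spanningCoe) ζ x y z}.ncard : ℝ)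

end UniformHypergraph

/-- The number of edges of `G` with one end in `A` and the other one in `B`. -/
noncomputable def numEdgesBetween {V : Type u} (G : SimpleGraph V) (A B : Set V) : ℕ :=
  {e | e ∈ G.edgeSet ∧ ∃ a ∈ A, ∃ b ∈ B, e = s(a, b)}.ncard

/-- A (finite) graph is `(β, ℓ)`-robust if between any two distinct vertices there are at least
`β |V(G)| ^ (ℓ - 1)` paths of length `ℓ`. -/
def IsRobust {W : Type u} (G : SimpleGraph W) (β : ℝ) (ℓ : ℕ) : Prop :=
  ∀ x y : W, x ≠ y →
    β * (Nat.card W : ℝ) ^ (ℓ - 1) ≤ ({P : G.Walk x y | P.IsPath ∧ P.length = ℓ}.ncard : ℝ)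

/-- `S` is a `(β, ℓ)`-robust induced subgraph of the graph `G`, where `G` is regarded as a graph
with finite vertex set `U`; `S` has at least `(2/3 + α/2)|U|` vertices, sends at most `μ|U|²` edges
of `G` to the other vertices, and has many edges. -/
structure IsLocatedRobustSubgraph {V : Type u} (U : Finset V) (G : SimpleGraph V) (S : G.Subgraph)
    (α μ β : ℝ) (ℓ : ℕ) : Prop where
  verts_subset : S.verts ⊆ (U : Set V)
  isInduced : S.IsInduced
  robust : IsRobust S.coe β ℓ
  card_verts : (2 / 3 + α / 2) * (#U : ℝ) ≤ (S.verts.ncard : ℝ)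
  cross_edges : (numEdgesBetween G S.verts ((U : Set V) \ S.verts) : ℝ) ≤ μ * (#U : ℝ) ^ 2
  card_edges : (5 / 9 + α / 2) * (#U : ℝ) ^ 2 / 2 - ((#U : ℝ) - (S.verts.ncard : ℝ)) ^ 2 / 2
    ≤ (S.edgeSet.ncard : ℝ)
  card_edges' : (4 / 9 + 2 / 3 * α) * (#U : ℝ) ^ 2 / 2
    ≤ (5 / 9 + α / 2) * (#U : ℝ) ^ 2 / 2 - ((#U : ℝ) - (S.verts.ncard : ℝ)) ^ 2 / 2

/-- The `4`-uniform setup for a hypergraph `H` and a family `R` of subgraphs of its pair links,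
indexed by unordered pairs. -/
structure IsFourUniformSetup {V : Type u} [DecidableEq V] (α β : ℝ) (ℓ : ℕ)
    (H : UniformHypergraph V 4) (R : ∀ p : Sym2 V, (H.pairLink p).Subgraph) : Prop where
  minDegree : (5 / 9 + α) * H.order ^ 2 / 2 ≤ (H.minDegree 2 : ℝ)
  located : ∀ u ∈ H.verts, ∀ v ∈ H.verts, u ≠ v →
    IsLocatedRobustSubgraph H.verts (H.pairLink s(u, v)) (R s(u, v)) α (α ^ 3 / 18) β ℓ

/-- Natural numbers `L 1, L 2, L 3, L 4 ≤ 50 ℓ` with `L i ≡ i` modulo `4`. -/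
def IsLengthSystem (ℓ : ℕ) (L : ℕ → ℕ) : Prop :=
  ∀ i ∈ Finset.Icc 1 4, L i ≤ 50 * ℓ ∧ L i ≡ i [MOD 4]

/-- `θ ∈ (0, 1]` is a connecting constant for `ζ` and the lengths `L`: in every sufficiently large
hypergraph as in the setup any two disjoint `ζ`-connectable triples are joined, for every
`i ∈ {1, 2, 3, 4}`, by at least `θ |V| ^ (L i)` paths with `L i` inner vertices. -/
def IsConnectingConstant (α β : ℝ) (ℓ : ℕ) (L : ℕ → ℕ) (ζ θ : ℝ) : Prop :=
  0 < θ ∧ θ ≤ 1 ∧ ∃ n₀ : ℕ, ∀ (V : Type u) [DecidableEq V] (H : UniformHypergraph V 4)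
    (R : ∀ p : Sym2 V, (H.pairLink p).Subgraph),
    n₀ ≤ #H.verts → IsFourUniformSetup α β ℓ H R →
      ∀ a b c x y z : V,
        H.IsConnectableTriple R ζ a b c → H.IsConnectableTriple R ζ x y z →
        Disjoint ({a, b, c} : Finset V) {x, y, z} →
        ∀ i ∈ Finset.Icc 1 4,
          θ * H.order ^ L i ≤ ((H.connectingPaths a b c x y z (L i)).ncard : ℝ)

/-!
The proof counts walks, with repeated vertices allowed, and works throughout with densities
(`Dens`): a dense set of pairs stays dense when one coordinate is replaced by several independent
copies (`Dens.blowUp`), so a dense family of degenerate walks, in which a vertex is used many times,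
yields a dense family of genuine ones.

*Connecting.*  A walk `c r₁ r₂ … p` in the graph `R_{uv}` becomes a tight walk of `H` if `v` and `u`
are inserted after every second vertex, because then any four consecutive vertices consist of `u`,
`v` and an edge of `R_{uv}`.  Given connectable triples `abc` and `xyz`, choose `v` for which `abc`
is a bridge, `u` with `bc ∈ R_{uv}`, and likewise `v'` and `u'` with `xy ∈ R_{u'v'}`.  Any two of the
robust graphs share many edges (`IsLocatedRobustSubgraph.dens_common`), so there are edges common to
`R_{uv}` and `R_{vv'}`, and to `R_{vv'}` and `R_{u'v'}`.  Hence three legs, in the graphs `R_{uv}`,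
`R_{vv'}` and `R_{u'v'}`, lead from `bc` to `xy`, and robustness makes each leg plentiful.  Copying
`v`, `u`, `v'` and `u'` turns this into many tight walks with `6 ℓ + 4` inner vertices
(`IsLinkSystem.connect`).  In the first leg the inserted pair is `v u`, in the last one it is
`u' v'`; passing through `R_{vv'}` is what allows the two vertices to change places.

*Residues.*  Since `6 ℓ + 4` is `2` modulo `4`, a walk through `j` intermediate connectable triples
has `j (6 ℓ + 7) + 6 ℓ + 4` inner vertices, which is `j + 2` modulo `4`; so `j = 0, 1, 2, 3` provide
all residues.  There are many connectable triples: for every `v`, most triples `pqr` with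
`pq ∈ R_{rv}` also satisfy `qr ∈ R_{pv}`, because `R_{rv}` contains ordered pairs of density at least
`4 / 9`, while the edges of the link of `pv` outside `R_{pv}` have density at most about `1 / 9`
(`IsFourUniformSetup.dens_bridges`).  Finally only few walks fail to be paths.

*Reservoir.*  A random set of density `3 / 4 * θ₁ ^ 2` has the required properties.  Instead of
probabilities, the proof rounds the constant weight `3 / 4 * θ₁ ^ 2` coordinate by coordinate to
`0` or `1`, keeping a sum of exponentials under control (`exists_rounding_on`): the numbers of paths
are multilinear in the weights and change little in each coordinate, and there are only polynomially
many of them.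
-/

/-! ### Density of predicates on finite types -/

/-- The predicate `P` has density at least `c` in the finite type `X`. -/
def Dens {X : Type*} (c : ℝ) (P : X → Prop) : Prop :=
  c * (Nat.card X : ℝ) ≤ (Nat.card {x // P x} : ℝ)

section Density

variable {X Y ι : Type*}

theorem natCard_subtype_le [Finite X] {P Q : X → Prop} (h : ∀ x, P x → Q x) :
    Nat.card {x // P x} ≤ Nat.card {x // Q x} :=
  Nat.card_le_card_of_injective (fun x : {x // P x} => (⟨x.1, h x.1 x.2⟩ : {x // Q x}))
    fun a b hab => Subtype.ext (by simpa using hab)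

theorem natCard_subtype_le_natCard [Finite X] (P : X → Prop) : Nat.card {x // P x} ≤ Nat.card X :=
  Nat.card_le_card_of_injective _ Subtype.val_injective

theorem natCard_subtype_or_le (P Q : X → Prop) :
    Nat.card {x // P x ∨ Q x} ≤ Nat.card {x // P x} + Nat.card {x // Q x} := by
  exact Set.ncard_union_le {x | P x} {x | Q x}

theorem natCard_subtype_le_of_imp_or [Finite X] {P Q R : X → Prop} (h : ∀ x, P x → Q x ∨ R x) :
    Nat.card {x // P x} ≤ Nat.card {x // Q x} + Nat.card {x // R x} :=
  (natCard_subtype_le h).trans (natCard_subtype_or_le Q R)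

theorem natCard_subtype_prod [Fintype X] [Finite Y] (P : X × Y → Prop) :
    Nat.card {p // P p} = ∑ x, Nat.card {y // P (x, y)} := by
  rw [← Nat.card_sigma]
  exact Nat.card_congr
    { toFun := fun p => ⟨p.1.1, p.1.2, p.2⟩
      invFun := fun p => ⟨(p.1, p.2.1), p.2.2⟩
      left_inv := fun _ => rfl
      right_inv := fun _ => rfl }

theorem natCard_subtype_equiv (e : X ≃ Y) (P : Y → Prop) :
    Nat.card {x // P (e x)} = Nat.card {y // P y} :=
  Nat.card_congr (e.subtypeEquiv fun _ => Iff.rfl)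

namespace Dens

theorem mono [Finite X] {c : ℝ} {P Q : X → Prop} (hP : Dens c P) (h : ∀ x, P x → Q x) : Dens c Q :=
  hP.trans (by exact_mod_cast natCard_subtype_le h)

theorem mono_const {c d : ℝ} {P : X → Prop} (hP : Dens c P) (h : d ≤ c) : Dens d P :=
  le_trans (mul_le_mul_of_nonneg_right h (Nat.cast_nonneg _)) hP

theorem of_equiv {c : ℝ} (e : X ≃ Y) {P : X → Prop} {Q : Y → Prop} (hP : Dens c P)
    (h : ∀ x, P x ↔ Q (e x)) : Dens c Q := by
  unfold Dens at *
  rwa [← Nat.card_congr e, ← Nat.card_congr (e.subtypeEquiv h)]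

theorem exists_of_pos [Nonempty X] [Finite X] {c : ℝ} (hc : 0 < c) {P : X → Prop}
    (hP : Dens c P) : ∃ x, P x := by
  have h1 : (0 : ℝ) < Nat.card X := by exact_mod_cast Nat.card_pos
  have h2 : (0 : ℝ) < Nat.card {x // P x} := lt_of_lt_of_le (mul_pos hc h1) hP
  have h3 : 0 < Nat.card {x // P x} := by exact_mod_cast h2
  obtain ⟨⟨x⟩, -⟩ := Nat.card_pos_iff.1 h3
  exact ⟨x.1, x.2⟩

theorem and_of_card_le [Finite X] {c d : ℝ} {P Q : X → Prop} (hP : Dens c P)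
    (h : (Nat.card {x // P x ∧ ¬ Q x} : ℝ) ≤ d * Nat.card X) :
    Dens (c - d) (fun x => P x ∧ Q x) := by
  have h1 : (Nat.card {x // P x} : ℝ) ≤
      Nat.card {x // P x ∧ Q x} + Nat.card {x // P x ∧ ¬ Q x} := by
    exact_mod_cast natCard_subtype_le_of_imp_or fun x hx => by tauto
  unfold Dens at *
  linarith

theorem prod [Finite X] [Finite Y] {c d : ℝ} (hd : 0 ≤ d) {P : X → Prop} {Q : X → Y → Prop} (hP : Dens c P)
    (hQ : ∀ x, P x → Dens d (Q x)) : Dens (c * d) (fun p : X × Y => P p.1 ∧ Q p.1 p.2) := by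
  have := Fintype.ofFinite X
  classical
  unfold Dens at *
  rw [natCard_subtype_prod, Nat.card_prod]
  push_cast
  have h1 : ∀ x, (if P x then d * (Nat.card Y : ℝ) else 0) ≤
      (Nat.card {y // P x ∧ Q x y} : ℝ) := by
    intro x
    split_ifs with h
    · refine (hQ x h).trans ?_
      exact_mod_cast natCard_subtype_le (P := Q x) (Q := fun y => P x ∧ Q x y) fun y hy => ⟨h, hy⟩
    · positivity
  refine le_trans ?_ (Finset.sum_le_sum fun x _ => h1 x)
  rw [← Finset.sum_filter, Finset.sum_const, nsmul_eq_mul]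
  have h2 : (#{x | P x} : ℝ) = Nat.card {x // P x} := by
    rw [Nat.card_eq_fintype_card, Fintype.card_subtype]
  rw [h2]
  calc _ = (c * Nat.card X) * (d * Nat.card Y) := by ring
    _ ≤ _ := mul_le_mul_of_nonneg_right hP (by positivity)

/-- Most pairs in a dense set of pairs lie in a dense fibre of any larger set. -/
theorem remove [Finite X] [Finite Y] {c ε : ℝ} (hε : 0 ≤ ε) {P Q : X × Y → Prop} (hP : Dens c P)
    (hPQ : ∀ p, P p → Q p) :
    Dens (c - ε) (fun p => P p ∧ Dens ε (fun y => Q (p.1, y))) := by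
  have := Fintype.ofFinite X
  refine hP.and_of_card_le ?_
  rw [natCard_subtype_prod, Nat.card_prod]
  push_cast
  have h1 : ∀ x : X, (Nat.card {y // P (x, y) ∧ ¬ Dens ε (fun y => Q (x, y))} : ℝ) ≤
      ε * Nat.card Y := by
    intro x
    by_cases h : Dens ε (fun y => Q (x, y))
    · simp only [h, not_true, and_false]
      simp only [Nat.card_of_isEmpty, Nat.cast_zero]
      positivity
    · have h2 := not_le.1 h
      refine le_trans ?_ h2.le
      exact_mod_cast natCard_subtype_le
        (P := fun y => P (x, y) ∧ ¬ Dens ε (fun y => Q (x, y))) fun y hy => hPQ _ hy.1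
  refine (Finset.sum_le_sum fun x _ => h1 x).trans (le_of_eq ?_)
  simp
  ring

/-- In a dense set of pairs, many first coordinates have dense fibres. -/
theorem markov [Finite X] [Finite Y] [Nonempty Y] {c : ℝ} (hc : 0 ≤ c) {P : X × Y → Prop} (hP : Dens c P) :
    Dens (c / 2) (fun x => Dens (c / 2) (fun y => P (x, y))) := by
  have := Fintype.ofFinite X
  have h1 := hP.remove (ε := c / 2) (by positivity) (fun p hp => hp)
  have h2 : Nat.card {p : X × Y // P p ∧ Dens (c / 2) (fun y => P (p.1, y))} ≤
      Nat.card {x // Dens (c / 2) (fun y => P (x, y))} * Nat.card Y := by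
    rw [← Nat.card_prod]
    refine Nat.card_le_card_of_injective (fun p => (⟨p.1.1, p.2.2⟩, p.1.2)) ?_
    rintro ⟨⟨a, b⟩, h⟩ ⟨⟨a', b'⟩, h'⟩ hab
    simp only [Prod.mk.injEq, Subtype.mk.injEq] at hab
    exact Subtype.ext (Prod.ext hab.1 hab.2)
  have h3 : (0 : ℝ) < Nat.card Y := by exact_mod_cast Nat.card_pos
  have h4 : ((Nat.card {p : X × Y // P p ∧ Dens (c / 2) (fun y => P (p.1, y))} : ℕ) : ℝ) ≤
      Nat.card {x // Dens (c / 2) (fun y => P (x, y))} * Nat.card Y := by exact_mod_cast h2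
  have h5 := le_trans h1 h4
  rw [Nat.card_prod] at h5
  push_cast at h5
  refine le_of_mul_le_mul_right ?_ h3
  linarith

/-- Blowing up the first coordinate: independent copies of it still form a dense set. -/
theorem blowUp [Finite X] [Finite Y] [Finite ι] {c : ℝ} (hc : 0 ≤ c) {P : X × Y → Prop} (hP : Dens c P) :
    Dens (c ^ Nat.card ι) (fun p : (ι → X) × Y => ∀ i, P (p.1 i, p.2)) := by
  have := Fintype.ofFinite Y
  have := Fintype.ofFinite ι
  have hfib : ∀ y : Y, Nat.card {f : ι → X // ∀ i, P (f i, y)} =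
      Nat.card {x // P (x, y)} ^ Nat.card ι := by
    intro y
    rw [← Nat.card_fun]
    exact Nat.card_congr (Equiv.subtypePiEquivPi (p := fun _ x => P (x, y)))
  have hsum : Nat.card {p : (ι → X) × Y // ∀ i, P (p.1 i, p.2)} =
      ∑ y, Nat.card {x // P (x, y)} ^ Nat.card ι := by
    rw [← natCard_subtype_equiv (Equiv.prodComm Y (ι → X))
      (fun p : (ι → X) × Y => ∀ i, P (p.1 i, p.2)), natCard_subtype_prod]
    exact Finset.sum_congr rfl fun y _ => hfib y
  have hsum' : Nat.card {p : X × Y // P p} = ∑ y, Nat.card {x // P (x, y)} := by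
    rw [← natCard_subtype_equiv (Equiv.prodComm Y X), natCard_subtype_prod]
    rfl
  unfold Dens at *
  rw [hsum, Nat.card_prod, Nat.card_fun]
  rw [hsum', Nat.card_prod] at hP
  push_cast at *
  rcases isEmpty_or_nonempty Y with hY | hY
  · simp
  have hN : (0 : ℝ) < Nat.card Y := by exact_mod_cast Nat.card_pos
  have hmean := Real.pow_arith_mean_le_arith_mean_pow (Finset.univ : Finset Y)
    (fun _ => ((Nat.card Y : ℝ))⁻¹) (fun y => (Nat.card {x // P (x, y)} : ℝ))
    (fun _ _ => by positivity) (by simp [Nat.card_eq_fintype_card]) (fun _ _ => by positivity)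
    (Nat.card ι)
  rw [← Finset.mul_sum, ← Finset.mul_sum] at hmean
  have h1 : c * Nat.card X ≤ (Nat.card Y : ℝ)⁻¹ * ∑ y, (Nat.card {x // P (x, y)} : ℝ) := by
    rw [le_inv_mul_iff₀ hN]
    linarith
  have h2 := (pow_le_pow_left₀ (by positivity) h1 (Nat.card ι)).trans hmean
  rw [le_inv_mul_iff₀ hN, mul_pow] at h2
  linarith

end Dens

end Density

/-! ### Tight walks and systems of link graphs -/

section Tight

variable {W : Type*}

/-- A sequence of vertices is a tight walk for the quaternary edge relation `E` if `E` holds for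
any four consecutive entries.  Repeated vertices are allowed. -/
def Tight (E : W → W → W → W → Prop) : List W → Prop
  | a :: b :: c :: d :: l => E a b c d ∧ Tight E (b :: c :: d :: l)
  | _ => True

/-- The walks with `m` inner vertices from the triple `abc` to the triple `xyz`, each given by the
list of its inner vertices. -/
def innerWalks (E : W → W → W → W → Prop) (a b c x y z : W) (m : ℕ) : Set (List W) :=
  {q | q.length = m ∧ Tight E ([a, b, c] ++ q ++ [x, y, z])}

theorem tight_of_cons {E : W → W → W → W → Prop} {a : W} {l : List W} (h : Tight E (a :: l)) :
    Tight E l := by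
  match l, h with
  | [], _ => trivial
  | [_], _ => trivial
  | [_, _], _ => trivial
  | _ :: _ :: _ :: _, h => exact h.2

theorem Tight.append_overlap {E : W → W → W → W → Prop} {p q r : W} {l₂ : List W} :
    ∀ {l₁ : List W}, Tight E (l₁ ++ [p, q, r]) → Tight E ([p, q, r] ++ l₂) →
      Tight E (l₁ ++ [p, q, r] ++ l₂)
  | [], _, h => h
  | [_], h, h' => ⟨h.1, h'⟩
  | [_, _], h, h' => ⟨h.1, h.2.1, h'⟩
  | [_, _, _], h, h' => ⟨h.1, h.2.1, h.2.2.1, h'⟩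
  | _ :: b :: c :: d :: l, h, h' =>
    ⟨h.1, Tight.append_overlap (l₁ := b :: c :: d :: l) h.2 h'⟩

theorem tight_infix {E : W → W → W → W → Prop} :
    ∀ {l : List W}, Tight E l → ∀ {a b c d : W}, [a, b, c, d] <:+: l → E a b c d
  | [], _, _, _, _, _, h => by simp at h
  | e :: l, hl, a, b, c, d, h => by
    rcases List.infix_cons_iff.1 h with h | h
    · obtain ⟨r, hr⟩ := h
      simp only [List.cons_append, List.nil_append, List.cons.injEq] at hr
      obtain ⟨rfl, rfl⟩ := hr
      exact hl.1
    · exact tight_infix (tight_of_cons hl) h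

/-- The sequence `s₀ t₀ e₁ s₁ t₁ e₂ … eₘ sₘ tₘ`, in which the ordered pairs `eᵢ` contribute two
consecutive entries each. -/
def weave (s t : ℕ → W) (e : ℕ → W × W) : ℕ → List W
  | 0 => [s 0, t 0]
  | m + 1 => s 0 :: t 0 :: (e 1).1 :: (e 1).2 ::
      weave (fun i => s (i + 1)) (fun i => t (i + 1)) (fun i => e (i + 1)) m

theorem length_weave (s t : ℕ → W) (e : ℕ → W × W) (m : ℕ) :
    (weave s t e m).length = 4 * m + 2 := by
  induction m generalizing s t e with
  | zero => rfl
  | succ m ih => simp [weave, ih]; ring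

theorem exists_weave_eq_cons (s t : ℕ → W) (e : ℕ → W × W) (m : ℕ) :
    ∃ l, weave s t e m = s 0 :: l := by
  cases m <;> exact ⟨_, rfl⟩

theorem weave_injective {s t s' t' : ℕ → W} {e e' : ℕ → W × W} {m : ℕ}
    (h : weave s t e m = weave s' t' e' m) :
    ∀ i ≤ m, s i = s' i ∧ t i = t' i ∧ (i ≠ 0 → e i = e' i) := by
  induction m generalizing s t e s' t' e' with
  | zero =>
    intro i hi
    obtain rfl : i = 0 := by omega
    simp only [weave, List.cons.injEq, and_true] at h
    exact ⟨h.1, h.2, fun h => absurd rfl h⟩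
  | succ m ih =>
    simp only [weave, List.cons.injEq] at h
    obtain ⟨h1, h2, h3, h4, h5⟩ := h
    rintro (_ | i) hi
    · exact ⟨h1, h2, fun h => absurd rfl h⟩
    · obtain ⟨h6, h7, h8⟩ := ih h5 i (by omega)
      refine ⟨h6, h7, fun _ => ?_⟩
      rcases eq_or_ne i 0 with rfl | hi0
      · exact Prod.ext h3 h4
      · exact h8 hi0

/-- For a graph `G`, the ordered pairs `e` and `f` are two edges of a walk `e.1 e.2 f.1 f.2`. -/
def Linked (G : W → W → Prop) (e f : W × W) : Prop :=
  G e.1 e.2 ∧ G e.2 f.1 ∧ G f.1 f.2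

/-- The sequence that starts with `e`, continues with the entries of `r`, and is constantly `f`
afterwards. -/
def endSeq {X : Type*} {m : ℕ} (e : X) (r : Fin m → X) (f : X) : ℕ → X
  | 0 => e
  | i + 1 => if h : i < m then r ⟨i, h⟩ else f

/-- The ordered pairs `e`, `r 0`, …, `r (m - 1)`, `f` form a walk in the graph `G`. -/
def IsLeg {m : ℕ} (G : W → W → Prop) (e : W × W) (r : Fin m → W × W) (f : W × W) : Prop :=
  ∀ i ≤ m, Linked G (endSeq e r f i) (endSeq e r f (i + 1))

/-- The properties of a large hypergraph setup on which the connection of triples rests.  Here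
`E` is the edge relation of a `4`-uniform hypergraph and `A u v` is the adjacency relation of the
robust subgraph of the link of `uv`.  Legs have `2 m` inner vertices, which corresponds to paths of
the odd length `2 m + 1`. -/
structure IsLinkSystem (E A : W → W → W → W → Prop) (m : ℕ) (α β γ : ℝ) : Prop where
  edge_swap : ∀ {a b c d}, E a b c d → E b a c d
  edge_rotate : ∀ {a b c d}, E a b c d → E b c d a
  edge_ne : ∀ {a b c d}, E a b c d → a ≠ b
  edge_of_adj : ∀ {u v x y}, A u v x y → E u v x y
  adj_comm : ∀ {u v x y}, A u v x y → A v u x y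
  common : ∀ {u v w}, u ≠ v → w ≠ v → Dens α (fun e : W × W => A u v e.1 e.2 ∧ A w v e.1 e.2)
  legs : ∀ {u v b c p q}, A u v b c → A u v p q → c ≠ p →
    Dens β (fun r : Fin m → W × W => IsLeg (A u v) (b, c) r (p, q))
  triples : Dens γ (fun e : W × W × W =>
    Dens γ (fun v => E v e.1 e.2.1 e.2.2 ∧ Dens γ (fun u => A u v e.1 e.2.1) ∧
      Dens γ (fun u => A u v e.2.1 e.2.2)))

/-- The triple `abc` is `ζ`-connectable with respect to the edge relation `E` and the graphs
`A u v`. -/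
def ConnTriple (E A : W → W → W → W → Prop) (ζ : ℝ) (a b c : W) : Prop :=
  Dens ζ (fun v => E v a b c ∧ Dens ζ (fun u => A u v a b) ∧ Dens ζ (fun u => A u v b c))

variable {E A : W → W → W → W → Prop}

theorem ConnTriple.mono [Finite W] {ζ ζ' : ℝ} {a b c : W} (h : ConnTriple E A ζ a b c)
    (h' : ζ' ≤ ζ) : ConnTriple E A ζ' a b c :=
  (Dens.mono_const h h').mono fun _ hv => ⟨hv.1, hv.2.1.mono_const h', hv.2.2.mono_const h'⟩

namespace IsLinkSystem

variable {k : ℕ} {α β γ : ℝ}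

theorem edge_last (hS : IsLinkSystem E A k α β γ) {s t x y : W} (h : A s t x y) : E x y s t :=
  hS.edge_rotate (hS.edge_rotate (hS.edge_of_adj h))

theorem edge_middle (hS : IsLinkSystem E A k α β γ) {s t x y : W} (h : A s t x y) : E x s t y :=
  hS.edge_swap (hS.edge_rotate (hS.edge_rotate (hS.edge_rotate
    (hS.edge_swap (hS.edge_rotate (hS.edge_of_adj h))))))

/-- If walks in the graphs `A (s i) (t i)` are woven with the vertices `s i` and `t i`, the
result is a tight walk. -/
theorem tight_weave (hS : IsLinkSystem E A k α β γ) {s t : ℕ → W} {e : ℕ → W × W} {m : ℕ}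
    (h1 : ∀ i ≤ m, Linked (A (s i) (t i)) (e i) (e (i + 1)))
    (h2 : ∀ i ≤ m, E (t i) (e (i + 1)).1 (e (i + 1)).2 (s (i + 1))) :
    Tight E ((e 0).1 :: (e 0).2 ::
      (weave s t e m ++ [(e (m + 1)).1, (e (m + 1)).2, s (m + 1)])) := by
  induction m generalizing s t e with
  | zero =>
    obtain ⟨h3, h4, h5⟩ := h1 0 le_rfl
    exact ⟨hS.edge_last h3, hS.edge_middle h4, hS.edge_of_adj h5, h2 0 le_rfl, trivial⟩
  | succ m ih =>
    obtain ⟨h3, h4, h5⟩ := h1 0 (Nat.zero_le _)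
    have ih' := ih (s := fun i => s (i + 1)) (t := fun i => t (i + 1)) (e := fun i => e (i + 1))
      (fun i hi => h1 (i + 1) (by omega)) (fun i hi => h2 (i + 1) (by omega))
    obtain ⟨l, hl⟩ := exists_weave_eq_cons (fun i => s (i + 1)) (fun i => t (i + 1))
      (fun i => e (i + 1)) m
    have h6 := h2 0 (Nat.zero_le _)
    simp only [weave, List.cons_append]
    rw [hl] at ih' ⊢
    exact ⟨hS.edge_last h3, hS.edge_middle h4, hS.edge_of_adj h5, h6, ih'⟩

end IsLinkSystem

end Tight

/-! ### Walks made of three legs and copies of four vertices -/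

section Connect

variable {W : Type*} {E A : W → W → W → W → Prop} {m : ℕ} {α β γ : ℝ}

/-- The conditions on vertices `v`, `u`, `v'`, `u'`, ordered pairs `f`, `g` and interior parts
`r₁`, `r₂`, `r₃` under which three walks, in the graphs `A u v`, `A v v'` and `A u' v'`, lead from
the pair `bc` via `f` and `g` to the pair `xy`. -/
def IsChain3 (E A : W → W → W → W → Prop) (a b c x y z : W) (v u v' u' : W)
    (f g : W × W) (r₁ r₂ r₃ : Fin m → W × W) : Prop :=
  E v a b c ∧ E v' x y z ∧ IsLeg (A u v) (b, c) r₁ f ∧ IsLeg (A v v') f r₂ g ∧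
    IsLeg (A u' v') g r₃ (x, y)

/-- The concatenation of three sequences of ordered pairs. -/
def endSeq3 (e : W × W) (r₁ : Fin m → W × W) (f : W × W) (r₂ : Fin m → W × W) (g : W × W)
    (r₃ : Fin m → W × W) (e' : W × W) (i : ℕ) : W × W :=
  if i ≤ m + 1 then endSeq e r₁ f i
  else if i ≤ 2 * (m + 1) then endSeq f r₂ g (i - (m + 1))
  else endSeq g r₃ e' (i - 2 * (m + 1))

theorem endSeq_last {X : Type*} (e : X) (r : Fin m → X) (f : X) : endSeq e r f (m + 1) = f := by
  simp [endSeq]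

theorem endSeq_succ_of_lt {X : Type*} {e : X} {r : Fin m → X} {f : X} {i : ℕ} (h : i < m) :
    endSeq e r f (i + 1) = r ⟨i, h⟩ := dif_pos h

theorem endSeq3_first {e : W × W} {r₁ : Fin m → W × W} {f : W × W} {r₂ : Fin m → W × W}
    {g : W × W} {r₃ : Fin m → W × W} {e' : W × W} {i : ℕ} (hi : i ≤ m + 1) :
    endSeq3 e r₁ f r₂ g r₃ e' i = endSeq e r₁ f i := if_pos hi

theorem endSeq3_second {e : W × W} {r₁ : Fin m → W × W} {f : W × W} {r₂ : Fin m → W × W}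
    {g : W × W} {r₃ : Fin m → W × W} {e' : W × W} {i : ℕ} (hi : i ≤ m + 1) :
    endSeq3 e r₁ f r₂ g r₃ e' (m + 1 + i) = endSeq f r₂ g i := by
  unfold endSeq3
  rcases Nat.eq_zero_or_pos i with rfl | h0
  · rw [if_pos (by omega), add_zero, endSeq_last]; rfl
  · rw [if_neg (by omega), if_pos (by omega), show m + 1 + i - (m + 1) = i by omega]

theorem endSeq3_third {e : W × W} {r₁ : Fin m → W × W} {f : W × W} {r₂ : Fin m → W × W}
    {g : W × W} {r₃ : Fin m → W × W} {e' : W × W} {i : ℕ} :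
    endSeq3 e r₁ f r₂ g r₃ e' (2 * (m + 1) + i) = endSeq g r₃ e' i := by
  unfold endSeq3
  rcases Nat.eq_zero_or_pos i with rfl | h0
  · rw [if_neg (by omega), if_pos (by omega), show 2 * (m + 1) + 0 - (m + 1) = m + 1 by omega,
      endSeq_last]
    rfl
  · rw [if_neg (by omega), if_neg (by omega), show 2 * (m + 1) + i - 2 * (m + 1) = i by omega]

/-- The function `ℕ → X` that lists the entries of `f`, then those of `g`, and is constantly `d`
afterwards. -/
def listing {X : Type*} {p q : ℕ} (f : Fin p → X) (g : Fin q → X) (d : X) (i : ℕ) : X :=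
  if h : i < p then f ⟨i, h⟩ else if h : i - p < q then g ⟨i - p, h⟩ else d

theorem listing_left {X : Type*} {p q : ℕ} {f : Fin p → X} {g : Fin q → X} {d : X} {i : ℕ}
    (h : i < p) : listing f g d i = f ⟨i, h⟩ := dif_pos h

theorem listing_right {X : Type*} {p q : ℕ} {f : Fin p → X} {g : Fin q → X} {d : X} {i : ℕ}
    (h : i < q) : listing f g d (p + i) = g ⟨i, h⟩ := by
  unfold listing
  rw [dif_neg (by omega), dif_pos (by omega)]
  congr 2
  omega

theorem listing_end {X : Type*} {p q : ℕ} {f : Fin p → X} {g : Fin q → X} {d : X} :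
    listing f g d (p + q) = d := by
  unfold listing
  rw [dif_neg (by omega), dif_neg (by omega)]

/-- The inner vertices of the walk made of copies of `v`, `u`, `v'`, `u'` and three walks in the
graphs `A u v`, `A v v'` and `A u' v'`. -/
def chainWalk (b c x y z : W) (v : Fin (2 * (m + 1)) → W) (u : Fin (m + 1) → W)
    (v' : Fin (2 * (m + 1)) → W) (u' : Fin (m + 1) → W) (f g : W × W)
    (r₁ r₂ r₃ : Fin m → W × W) : List W :=
  weave (listing v u' z) (listing u v' z) (endSeq3 (b, c) r₁ f r₂ g r₃ (x, y)) (3 * m + 2)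

theorem length_chainWalk (b c x y z : W) (v : Fin (2 * (m + 1)) → W) (u : Fin (m + 1) → W)
    (v' : Fin (2 * (m + 1)) → W) (u' : Fin (m + 1) → W) (f g : W × W)
    (r₁ r₂ r₃ : Fin m → W × W) :
    (chainWalk b c x y z v u v' u' f g r₁ r₂ r₃).length = 12 * m + 10 := by
  rw [chainWalk, length_weave]
  ring

theorem tight_chainWalk (hS : IsLinkSystem E A m α β γ) {a b c x y z : W}
    {v : Fin (2 * (m + 1)) → W} {u : Fin (m + 1) → W} {v' : Fin (2 * (m + 1)) → W}
    {u' : Fin (m + 1) → W} {f g : W × W} {r₁ r₂ r₃ : Fin m → W × W}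
    (h : ∀ i j i' j', IsChain3 E A a b c x y z (v i) (u j) (v' i') (u' j') f g r₁ r₂ r₃) :
    Tight E ([a, b, c] ++ chainWalk b c x y z v u v' u' f g r₁ r₂ r₃ ++ [x, y, z]) := by
  set s := listing v u' z with hs
  set t := listing u v' z with ht
  set e := endSeq3 (b, c) r₁ f r₂ g r₃ (x, y) with he
  have h0 : e 0 = (b, c) := by rw [he, endSeq3_first (by omega)]; rfl
  have hend : e (3 * m + 2 + 1) = (x, y) := by
    rw [he, show 3 * m + 2 + 1 = 2 * (m + 1) + (m + 1) by ring, endSeq3_third, endSeq_last]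
  have hsend : s (3 * m + 2 + 1) = z := by
    rw [hs, show 3 * m + 2 + 1 = 2 * (m + 1) + (m + 1) by ring, listing_end]
  have hlink : ∀ i ≤ 3 * m + 2, Linked (A (s i) (t i)) (e i) (e (i + 1)) := by
    intro i hi
    have hswap : ∀ {p q : W} {d d' : W × W}, Linked (A p q) d d' → Linked (A q p) d d' :=
      fun h => ⟨hS.adj_comm h.1, hS.adj_comm h.2.1, hS.adj_comm h.2.2⟩
    rcases lt_or_ge i (m + 1) with h1 | h1
    · rw [hs, ht, he, listing_left (by omega), listing_left h1, endSeq3_first (by omega),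
        endSeq3_first (by omega)]
      exact hswap ((h _ _ ⟨0, by omega⟩ ⟨0, by omega⟩).2.2.1 i (by omega))
    obtain ⟨j, rfl⟩ := Nat.exists_eq_add_of_le h1
    rcases lt_or_ge j (m + 1) with h2 | h2
    · rw [hs, ht, he, listing_left (by omega), listing_right (by omega), add_assoc (m + 1) j 1,
        endSeq3_second (by omega), endSeq3_second (by omega)]
      exact (h _ ⟨0, by omega⟩ _ ⟨0, by omega⟩).2.2.2.1 j (by omega)
    · obtain ⟨j, rfl⟩ := Nat.exists_eq_add_of_le h2
      rw [ht, listing_right (by omega), hs, he, ← add_assoc (m + 1) (m + 1) j, ← two_mul,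
        listing_right (by omega), add_assoc (2 * (m + 1)) j 1, endSeq3_third, endSeq3_third]
      exact (h ⟨0, by omega⟩ ⟨0, by omega⟩ _ _).2.2.2.2 j (by omega)
  -- Where the second vertex `t i` of an inserted pair meets the first vertex of the next one, the
  -- pair between them is an edge of the graph of both: at the two changes of legs it is an edge
  -- common to both legs, and at the end the edge is `v' x y z`.
  have hcross : ∀ i ≤ 3 * m + 2, E (t i) (e (i + 1)).1 (e (i + 1)).2 (s (i + 1)) := by
    intro i hi
    rcases Nat.lt_or_ge i (3 * m + 2) with hi' | hi'
    · have key : A (s (i + 1)) (t i) (e (i + 1)).1 (e (i + 1)).2 := by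
        rcases lt_or_ge i (m + 1) with h1 | h1
        · rw [hs, ht, he, listing_left (by omega), listing_left h1, endSeq3_first (by omega)]
          exact hS.adj_comm ((h _ _ ⟨0, by omega⟩ ⟨0, by omega⟩).2.2.1 i (by omega)).2.2
        obtain ⟨j, rfl⟩ := Nat.exists_eq_add_of_le h1
        rcases lt_or_ge j m with h2 | h2
        · rw [add_assoc (m + 1) j 1, hs, ht, he, listing_left (by omega),
            listing_right (by omega), endSeq3_second (by omega)]
          exact ((h _ ⟨0, by omega⟩ _ ⟨0, by omega⟩).2.2.2.1 j (by omega)).2.2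
        · obtain ⟨j, rfl⟩ := Nat.exists_eq_add_of_le h2
          rw [ht, listing_right (by omega), hs, he,
            show m + 1 + (m + j) + 1 = 2 * (m + 1) + j by ring,
            listing_right (by omega), endSeq3_third]
          exact ((h ⟨0, by omega⟩ ⟨0, by omega⟩ _ _).2.2.2.2 j (by omega)).1
      exact hS.edge_rotate (hS.edge_of_adj key)
    · obtain rfl : i = 3 * m + 2 := by omega
      rw [hend, hsend, ht, show 3 * m + 2 = m + 1 + (2 * m + 1) by ring,
        listing_right (by omega)]
      exact (h ⟨0, by omega⟩ ⟨0, by omega⟩ _ ⟨0, by omega⟩).2.1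
  have hT := hS.tight_weave hlink hcross
  rw [h0, hend, hsend] at hT
  have hfirst : E a b c (s 0) := by
    rw [hs, listing_left (by omega)]
    exact hS.edge_rotate (h _ ⟨0, by omega⟩ ⟨0, by omega⟩ ⟨0, by omega⟩).1
  obtain ⟨l, hl⟩ := exists_weave_eq_cons s t e (3 * m + 2)
  have hc : chainWalk b c x y z v u v' u' f g r₁ r₂ r₃ = s 0 :: l := hl
  rw [hl] at hT
  rw [hc]
  exact ⟨hfirst, hT⟩

theorem chainWalk_injective {b c x y z : W} {v v₁ : Fin (2 * (m + 1)) → W}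
    {u u₁ : Fin (m + 1) → W} {v' v₁' : Fin (2 * (m + 1)) → W} {u' u₁' : Fin (m + 1) → W}
    {f g f₁ g₁ : W × W} {r₁ r₂ r₃ q₁ q₂ q₃ : Fin m → W × W}
    (h : chainWalk b c x y z v u v' u' f g r₁ r₂ r₃ =
      chainWalk b c x y z v₁ u₁ v₁' u₁' f₁ g₁ q₁ q₂ q₃) :
    v = v₁ ∧ u = u₁ ∧ v' = v₁' ∧ u' = u₁' ∧ f = f₁ ∧ g = g₁ ∧ r₁ = q₁ ∧ r₂ = q₂ ∧ r₃ = q₃ := by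
  have key := weave_injective h
  refine ⟨?_, ?_, ?_, ?_, ?_, ?_, ?_, ?_, ?_⟩
  · ext i
    have := (key i (by omega)).1
    rwa [listing_left i.2, listing_left i.2] at this
  · ext i
    have := (key i (by omega)).2.1
    rwa [listing_left i.2, listing_left i.2] at this
  · ext i
    have := (key (m + 1 + i) (by omega)).2.1
    rwa [listing_right i.2, listing_right i.2] at this
  · ext i
    have := (key (2 * (m + 1) + i) (by omega)).1
    rwa [listing_right i.2, listing_right i.2] at this
  · have := (key (m + 1) (by omega)).2.2 (by omega)
    rwa [endSeq3_first le_rfl, endSeq3_first le_rfl, endSeq_last, endSeq_last] at this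
  · have := (key (2 * (m + 1) + 0) (by omega)).2.2 (by omega)
    rwa [endSeq3_third, endSeq3_third] at this
  · funext i
    have := (key (i + 1) (by omega)).2.2 (by omega)
    rwa [endSeq3_first (by omega), endSeq3_first (by omega), endSeq_succ_of_lt i.2, endSeq_succ_of_lt i.2] at this
  · funext i
    have := (key (m + 1 + (i + 1)) (by omega)).2.2 (by omega)
    rwa [endSeq3_second (by omega), endSeq3_second (by omega), endSeq_succ_of_lt i.2, endSeq_succ_of_lt i.2]
      at this
  · funext i
    have := (key (2 * (m + 1) + (i + 1)) (by omega)).2.2 (by omega)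
    rwa [endSeq3_third, endSeq3_third, endSeq_succ_of_lt i.2, endSeq_succ_of_lt i.2] at this

end Connect

/-! ### Connecting walks in a link system -/

section Connect

variable {W : Type*} {E A : W → W → W → W → Prop} {m : ℕ} {α β γ : ℝ}

theorem natCard_fst_eq [Finite W] (c : W) :
    Nat.card {e : W × W // e.1 = c} = Nat.card W :=
  Nat.card_congr
    { toFun := fun e => e.1.2
      invFun := fun w => ⟨(c, w), rfl⟩
      left_inv := by rintro ⟨⟨a, b⟩, rfl⟩; rfl
      right_inv := fun _ => rfl }

theorem natCard_snd_eq [Finite W] (c : W) :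
    Nat.card {e : W × W // e.2 = c} = Nat.card W :=
  Nat.card_congr
    { toFun := fun e => e.1.1
      invFun := fun w => ⟨(w, c), rfl⟩
      left_inv := by rintro ⟨⟨a, b⟩, rfl⟩; rfl
      right_inv := fun _ => rfl }

/-- In a large set of vertices, two prescribed coincidences hardly affect the density of a set of
ordered pairs. -/
theorem Dens.and_ne_and_ne [Finite W] {c : ℝ} {P : W × W → Prop} (hP : Dens c P) (p q : W)
    (hN : 4 ≤ c * Nat.card W) : Dens (c / 2) (fun e => P e ∧ e.1 ≠ p ∧ e.2 ≠ q) := by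
  have h1 : Nat.card {e : W × W // P e ∧ ¬ (e.1 ≠ p ∧ e.2 ≠ q)} ≤ Nat.card W + Nat.card W := by
    have h := natCard_subtype_le_of_imp_or (P := fun e : W × W => P e ∧ ¬ (e.1 ≠ p ∧ e.2 ≠ q))
      (Q := fun e => e.1 = p) (R := fun e => e.2 = q) fun e he => by tauto
    rwa [natCard_fst_eq, natCard_snd_eq] at h
  refine (hP.and_of_card_le (d := c / 2) ?_).mono_const (by linarith)
  have h2 : ((Nat.card {e : W × W // P e ∧ ¬ (e.1 ≠ p ∧ e.2 ≠ q)} : ℕ) : ℝ) ≤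
      Nat.card W + Nat.card W := by exact_mod_cast h1
  refine h2.trans ?_
  rw [Nat.card_prod]
  push_cast
  nlinarith [(Nat.cast_nonneg (Nat.card W) : (0 : ℝ) ≤ Nat.card W)]

theorem Dens.and_ne [Finite W] {c : ℝ} {P : W → Prop} (hP : Dens c P) (p : W)
    (hN : 2 ≤ c * Nat.card W) : Dens (c / 2) (fun e => P e ∧ e ≠ p) := by
  refine (hP.and_of_card_le (d := c / 2) ?_).mono_const (by linarith)
  have h1 : Nat.card {e : W // P e ∧ ¬ e ≠ p} ≤ Nat.card {e // e = p} :=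
    natCard_subtype_le fun e he => by tauto
  have h2 : Nat.card {e // e = p} = 1 := by simp
  have h3 : ((Nat.card {e : W // P e ∧ ¬ e ≠ p} : ℕ) : ℝ) ≤ 1 := by exact_mod_cast h2 ▸ h1
  linarith

namespace IsLinkSystem

/-- Chains of three legs are dense: all vertices and pairs can be chosen one after the other. -/
theorem dens_isChain3 [Finite W] (hS : IsLinkSystem E A m α β γ) (hα : 0 < α) (hβ : 0 < β)
    {ζ : ℝ} (hζ : 0 < ζ) (hNα : 4 ≤ α * Nat.card W) (hNζ : 2 ≤ ζ * Nat.card W)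
    {a b c x y z : W} (h : ConnTriple E A ζ a b c) (h' : ConnTriple E A ζ x y z) :
    Dens (ζ * (ζ * (ζ / 2 * (ζ * (α / 2 * (α / 2 * (β * (β * β))))))))
      (fun t : W × W × W × W × (W × W) × (W × W) × (Fin m → W × W) × (Fin m → W × W) ×
          (Fin m → W × W) =>
        IsChain3 E A a b c x y z t.1 t.2.1 t.2.2.1 t.2.2.2.1 t.2.2.2.2.1 t.2.2.2.2.2.1
          t.2.2.2.2.2.2.1 t.2.2.2.2.2.2.2.1 t.2.2.2.2.2.2.2.2) := by
  -- The transition edges `f` and `g` avoid coincidences, since legs need distinct end vertices.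
  have hpairs : ∀ u v v' u' : W, u ≠ v → v' ≠ v → u' ≠ v' → A u v b c → A u' v' x y →
      Dens (α / 2 * (α / 2 * (β * (β * β))))
        (fun t : (W × W) × (W × W) × (Fin m → W × W) × (Fin m → W × W) × (Fin m → W × W) =>
          IsLeg (A u v) (b, c) t.2.2.1 t.1 ∧ IsLeg (A v v') t.1 t.2.2.2.1 t.2.1 ∧
            IsLeg (A u' v') t.2.1 t.2.2.2.2 (x, y)) := by
    intro u v v' u' huv hvv' huv' hbc hxy
    have h1 := (hS.common huv hvv').and_ne_and_ne c c hNα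
    have h2 : ∀ e : W × W,
        Dens (α / 2) (fun f : W × W => (A v v' f.1 f.2 ∧ A u' v' f.1 f.2) ∧ f.1 ≠ e.2 ∧ f.2 ≠ x) :=
      fun e => (hS.common hvv'.symm huv').and_ne_and_ne e.2 x hNα
    refine (h1.prod (by positivity) fun f hf => (h2 f).prod (by positivity) fun g hg =>
      (hS.legs hbc hf.1.1 hf.2.1.symm).prod (by positivity) fun r₁ _ =>
        (hS.legs (hS.adj_comm hf.1.2) hg.1.1 hg.2.1.symm).prod (by positivity) fun r₂ _ =>
          hS.legs hg.1.2 hxy hg.2.2).mono ?_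
    rintro ⟨f, g, r₁, r₂, r₃⟩ ⟨-, -, h3, h4, h5⟩
    exact ⟨h3, h4, h5⟩
  -- The link of `v v'` is only of use when `v ≠ v'`.
  have h1 : ∀ v : W, Dens (ζ / 2) (fun v' => (E v' x y z ∧ Dens ζ (fun u => A u v' x y) ∧
      Dens ζ (fun u => A u v' y z)) ∧ v' ≠ v) := fun v => Dens.and_ne h' v hNζ
  refine (Dens.prod (by positivity) h fun v hv => hv.2.2.prod (by positivity) fun u hu =>
    (h1 v).prod (by positivity) fun v' hv' => hv'.1.2.1.prod (by positivity) fun u' hu' =>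
      hpairs u v v' u' (hS.edge_ne (hS.edge_of_adj hu)) hv'.2
        (hS.edge_ne (hS.edge_of_adj hu')) hu hu').mono ?_
  rintro ⟨v, u, v', u', f, g, r₁, r₂, r₃⟩ ⟨hv, hu, hv', hu', h3⟩
  exact ⟨hv.1, hv'.1.1, h3⟩

end IsLinkSystem

theorem finite_innerWalks [Finite W] (E : W → W → W → W → Prop) (a b c x y z : W) (l : ℕ) :
    (innerWalks E a b c x y z l).Finite :=
  (List.finite_length_eq W l).subset fun _ h => h.1

/-- A lower bound for the density of the walks with `12 m + 10` inner vertices between two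
`ζ`-connectable triples. -/
noncomputable def connConst (m : ℕ) (α β ζ : ℝ) : ℝ :=
  ((((ζ * (ζ * (ζ / 2 * (ζ * (α / 2 * (α / 2 * (β * (β * β)))))))) ^ (2 * (m + 1))) ^ (m + 1)) ^
    (2 * (m + 1))) ^ (m + 1)

theorem connConst_pos (m : ℕ) {α β ζ : ℝ} (hα : 0 < α) (hβ : 0 < β) (hζ : 0 < ζ) :
    0 < connConst m α β ζ := by
  unfold connConst
  positivity

/-- Any two connectable triples are joined by many walks with `12 m + 10` inner vertices. -/
theorem IsLinkSystem.connect [Finite W] (hS : IsLinkSystem E A m α β γ) (hα : 0 < α) (hβ : 0 < β)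
    {ζ : ℝ} (hζ : 0 < ζ) (hNα : 4 ≤ α * Nat.card W) (hNζ : 2 ≤ ζ * Nat.card W)
    {a b c x y z : W} (h : ConnTriple E A ζ a b c) (h' : ConnTriple E A ζ x y z) :
    connConst m α β ζ * (Nat.card W : ℝ) ^ (12 * m + 10) ≤
      ((innerWalks E a b c x y z (12 * m + 10)).ncard : ℝ) := by
  unfold connConst
  have h0 := hS.dens_isChain3 hα hβ hζ hNα hNζ h h'
  generalize hκ : ζ * (ζ * (ζ / 2 * (ζ * (α / 2 * (α / 2 * (β * (β * β))))))) = κ at h0 ⊢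
  have hκ0 : 0 ≤ κ := by rw [← hκ]; positivity
  -- The four vertices are replaced by independent copies one after the other.
  have h1 := Dens.blowUp (ι := Fin (2 * (m + 1))) hκ0 h0
  have h2 := h1.of_equiv (Q := fun t : W × W × W × ((W × W) × (W × W) × (Fin m → W × W) ×
      (Fin m → W × W) × (Fin m → W × W)) × (Fin (2 * (m + 1)) → W) =>
      ∀ i, IsChain3 E A a b c x y z (t.2.2.2.2 i) t.1 t.2.1 t.2.2.1 t.2.2.2.1.1 t.2.2.2.1.2.1
        t.2.2.2.1.2.2.1 t.2.2.2.1.2.2.2.1 t.2.2.2.1.2.2.2.2)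
    ⟨fun t => (t.2.1, t.2.2.1, t.2.2.2.1, t.2.2.2.2, t.1),
      fun t => (t.2.2.2.2, t.1, t.2.1, t.2.2.1, t.2.2.2.1), fun _ => rfl, fun _ => rfl⟩
    (fun _ => Iff.rfl)
  have h3 := Dens.blowUp (ι := Fin (m + 1)) (by positivity) h2
  have h4 := h3.of_equiv (Q := fun t : W × W × ((W × W) × (W × W) × (Fin m → W × W) ×
      (Fin m → W × W) × (Fin m → W × W)) × (Fin (2 * (m + 1)) → W) × (Fin (m + 1) → W) =>
      ∀ j i, IsChain3 E A a b c x y z (t.2.2.2.1 i) (t.2.2.2.2 j) t.1 t.2.1 t.2.2.1.1 t.2.2.1.2.1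
        t.2.2.1.2.2.1 t.2.2.1.2.2.2.1 t.2.2.1.2.2.2.2)
    ⟨fun t => (t.2.1, t.2.2.1, t.2.2.2.1, t.2.2.2.2, t.1),
      fun t => (t.2.2.2.2, t.1, t.2.1, t.2.2.1, t.2.2.2.1), fun _ => rfl, fun _ => rfl⟩
    (fun _ => Iff.rfl)
  have h5 := Dens.blowUp (ι := Fin (2 * (m + 1))) (by positivity) h4
  have h6 := h5.of_equiv (Q := fun t : W × ((W × W) × (W × W) × (Fin m → W × W) ×
      (Fin m → W × W) × (Fin m → W × W)) × (Fin (2 * (m + 1)) → W) × (Fin (m + 1) → W) ×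
        (Fin (2 * (m + 1)) → W) =>
      ∀ i' j i, IsChain3 E A a b c x y z (t.2.2.1 i) (t.2.2.2.1 j) (t.2.2.2.2 i') t.1 t.2.1.1
        t.2.1.2.1 t.2.1.2.2.1 t.2.1.2.2.2.1 t.2.1.2.2.2.2)
    ⟨fun t => (t.2.1, t.2.2.1, t.2.2.2.1, t.2.2.2.2, t.1),
      fun t => (t.2.2.2.2, t.1, t.2.1, t.2.2.1, t.2.2.2.1), fun _ => rfl, fun _ => rfl⟩
    (fun _ => Iff.rfl)
  have h7 := Dens.blowUp (ι := Fin (m + 1)) (by positivity) h6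
  unfold Dens at h7
  simp only [Nat.card_fin, Nat.card_prod, Nat.card_fun] at h7
  have hfin : Finite (innerWalks E a b c x y z (12 * m + 10)) := finite_innerWalks ..
  have hcount := Nat.card_le_card_of_injective (β := innerWalks E a b c x y z (12 * m + 10))
    (fun t : {t : (Fin (m + 1) → W) × ((W × W) × (W × W) × (Fin m → W × W) ×
      (Fin m → W × W) × (Fin m → W × W)) × (Fin (2 * (m + 1)) → W) × (Fin (m + 1) → W) ×
        (Fin (2 * (m + 1)) → W) //
      ∀ j' i' j i, IsChain3 E A a b c x y z (t.2.2.1 i) (t.2.2.2.1 j) (t.2.2.2.2 i') (t.1 j')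
        t.2.1.1 t.2.1.2.1 t.2.1.2.2.1 t.2.1.2.2.2.1 t.2.1.2.2.2.2} =>
      ⟨chainWalk b c x y z t.1.2.2.1 t.1.2.2.2.1 t.1.2.2.2.2 t.1.1 t.1.2.1.1 t.1.2.1.2.1
        t.1.2.1.2.2.1 t.1.2.1.2.2.2.1 t.1.2.1.2.2.2.2, length_chainWalk .., tight_chainWalk hS
          fun i j i' j' => t.2 j' i' j i⟩) (by
      rintro ⟨⟨u', ⟨f, g, r₁, r₂, r₃⟩, v, u, v'⟩, ht⟩ ⟨⟨u₁', ⟨f₁, g₁, q₁, q₂, q₃⟩, v₁, u₁, v₁'⟩, ht'⟩ h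
      obtain ⟨rfl, rfl, rfl, rfl, rfl, rfl, rfl, rfl, rfl⟩ :=
        chainWalk_injective (Subtype.ext_iff.1 h)
      rfl)
  have hcount' : ((Nat.card {t : (Fin (m + 1) → W) × ((W × W) × (W × W) × (Fin m → W × W) ×
      (Fin m → W × W) × (Fin m → W × W)) × (Fin (2 * (m + 1)) → W) × (Fin (m + 1) → W) ×
        (Fin (2 * (m + 1)) → W) //
      ∀ j' i' j i, IsChain3 E A a b c x y z (t.2.2.1 i) (t.2.2.2.1 j) (t.2.2.2.2 i') (t.1 j')
        t.2.1.1 t.2.1.2.1 t.2.1.2.2.1 t.2.1.2.2.2.1 t.2.1.2.2.2.2} : ℕ) : ℝ) ≤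
      ((innerWalks E a b c x y z (12 * m + 10)).ncard : ℝ) := by exact_mod_cast hcount
  refine le_trans (le_of_eq ?_) (h7.trans hcount')
  congr 1
  push_cast
  ring

/-- Walks may be concatenated at any of the many connectable triples. -/
theorem IsLinkSystem.compose [Finite W] (hS : IsLinkSystem E A m α β γ)
    {θ₁ θ₂ : ℝ} (hθ₁ : 0 ≤ θ₁) (hθ₂ : 0 ≤ θ₂) {l₁ l₂ : ℕ} {a b c x y z : W}
    (h₁ : ∀ p q r : W, ConnTriple E A γ p q r →
      θ₁ * (Nat.card W : ℝ) ^ l₁ ≤ ((innerWalks E a b c p q r l₁).ncard : ℝ))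
    (h₂ : ∀ p q r : W, ConnTriple E A γ p q r →
      θ₂ * (Nat.card W : ℝ) ^ l₂ ≤ ((innerWalks E p q r x y z l₂).ncard : ℝ)) :
    γ * (θ₁ * θ₂) * (Nat.card W : ℝ) ^ (l₁ + 3 + l₂) ≤
      ((innerWalks E a b c x y z (l₁ + 3 + l₂)).ncard : ℝ) := by
  let T := {e : W × W × W // ConnTriple E A γ e.1 e.2.1 e.2.2}
  have hfin₁ : ∀ e : T, Finite (innerWalks E a b c e.1.1 e.1.2.1 e.1.2.2 l₁) :=
    fun e => finite_innerWalks ..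
  have hfin₂ : ∀ e : T, Finite (innerWalks E e.1.1 e.1.2.1 e.1.2.2 x y z l₂) :=
    fun e => finite_innerWalks ..
  have hfin : Finite (innerWalks E a b c x y z (l₁ + 3 + l₂)) := finite_innerWalks ..
  have := Fintype.ofFinite T
  have hcount := Nat.card_le_card_of_injective (β := innerWalks E a b c x y z (l₁ + 3 + l₂))
    (fun t : Σ e : T, innerWalks E a b c e.1.1 e.1.2.1 e.1.2.2 l₁ ×
        innerWalks E e.1.1 e.1.2.1 e.1.2.2 x y z l₂ =>
      ⟨t.2.1.1 ++ [t.1.1.1, t.1.1.2.1, t.1.1.2.2] ++ t.2.2.1,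
        by simp [t.2.1.2.1, t.2.2.2.1]; ring, by
          have := Tight.append_overlap (l₁ := [a, b, c] ++ t.2.1.1) (l₂ := t.2.2.1 ++ [x, y, z])
            t.2.1.2.2 (by simpa using t.2.2.2.2)
          simpa using this⟩) (by
      rintro ⟨⟨⟨p, q, r⟩, h⟩, ⟨q₁, hq₁⟩, ⟨q₂, hq₂⟩⟩ ⟨⟨⟨p', q', r'⟩, h'⟩, ⟨q₁', hq₁'⟩, ⟨q₂', hq₂'⟩⟩ heq
      have heq' := Subtype.ext_iff.1 heq
      simp only [List.append_assoc] at heq'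
      obtain ⟨h3, h4⟩ := List.append_inj heq' (hq₁.1.trans hq₁'.1.symm)
      obtain ⟨h5, h6⟩ := List.append_inj h4 rfl
      simp only [List.cons.injEq, and_true] at h5
      obtain ⟨rfl, rfl, rfl⟩ := h5
      subst h3 h6
      rfl)
  have hcount' : ((Nat.card (Σ e : T, innerWalks E a b c e.1.1 e.1.2.1 e.1.2.2 l₁ ×
      innerWalks E e.1.1 e.1.2.1 e.1.2.2 x y z l₂) : ℕ) : ℝ) ≤
      ((innerWalks E a b c x y z (l₁ + 3 + l₂)).ncard : ℝ) := by exact_mod_cast hcount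
  refine le_trans ?_ hcount'
  rw [Nat.card_sigma]
  push_cast
  have hterm : ∀ e : T, θ₁ * (Nat.card W : ℝ) ^ l₁ * (θ₂ * (Nat.card W : ℝ) ^ l₂) ≤
      ((Nat.card (innerWalks E a b c e.1.1 e.1.2.1 e.1.2.2 l₁ ×
        innerWalks E e.1.1 e.1.2.1 e.1.2.2 x y z l₂) : ℕ) : ℝ) := by
    intro e
    rw [Nat.card_prod]
    push_cast
    exact mul_le_mul (h₁ _ _ _ e.2) (h₂ _ _ _ e.2) (by positivity) (by positivity)
  refine le_trans ?_ (Finset.sum_le_sum fun e _ => hterm e)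
  rw [Finset.sum_const, nsmul_eq_mul, Finset.card_univ, ← Nat.card_eq_fintype_card]
  have htr : γ * (Nat.card (W × W × W) : ℝ) ≤ (Nat.card T : ℝ) := hS.triples
  rw [Nat.card_prod, Nat.card_prod] at htr
  push_cast at htr
  calc _ = (γ * ((Nat.card W : ℝ) * (Nat.card W * Nat.card W))) *
        (θ₁ * (Nat.card W : ℝ) ^ l₁ * (θ₂ * (Nat.card W : ℝ) ^ l₂)) := by ring
    _ ≤ _ := mul_le_mul_of_nonneg_right htr (by positivity)

/-- Passing through `j` intermediate triples changes the number of inner vertices by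
`j (12 m + 13)`. -/
theorem exists_connect (m : ℕ) (hα : 0 < α) (hβ : 0 < β) (hγ : 0 < γ) {ζ : ℝ} (hζ : 0 < ζ)
    (hζγ : ζ ≤ γ) (j : ℕ) :
    ∃ θ : ℝ, 0 < θ ∧ ∀ (W : Type u) [Finite W] (E A : W → W → W → W → Prop),
      IsLinkSystem E A m α β γ → 4 ≤ α * Nat.card W → 2 ≤ ζ * Nat.card W →
      ∀ a b c x y z : W, ConnTriple E A ζ a b c → ConnTriple E A ζ x y z →
        θ * (Nat.card W : ℝ) ^ (j * (12 * m + 13) + (12 * m + 10)) ≤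
          ((innerWalks E a b c x y z (j * (12 * m + 13) + (12 * m + 10))).ncard : ℝ) := by
  induction j with
  | zero =>
    refine ⟨connConst m α β ζ, connConst_pos m hα hβ hζ, ?_⟩
    intro W _ E A hS hNα hNζ a b c x y z h h'
    rw [zero_mul, zero_add]
    exact hS.connect hα hβ hζ hNα hNζ h h'
  | succ j ih =>
    obtain ⟨θ, hθ, hconn⟩ := ih
    have hκ := connConst_pos m hα hβ hζ
    refine ⟨γ * (θ * connConst m α β ζ), by positivity, ?_⟩
    intro W _ E A hS hNα hNζ a b c x y z h h'
    have h3 := hS.compose hθ.le hκ.le (a := a) (b := b) (c := c) (x := x) (y := y) (z := z)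
      (fun p q r hpqr => hconn W E A hS hNα hNζ a b c p q r h (hpqr.mono hζγ))
      (fun p q r hpqr => hS.connect hα hβ hζ hNα hNζ (hpqr.mono hζγ) h')
    rwa [show j * (12 * m + 13) + (12 * m + 10) + 3 + (12 * m + 10) =
      (j + 1) * (12 * m + 13) + (12 * m + 10) by ring] at h3

end Connect

/-! ### Paths of a robust graph as legs -/

section Walks

/-- The paths of length `2 m + 1` between two vertices give distinct legs. -/
theorem ncard_paths_le_natCard_legs {X W : Type*} [Finite W] {G : SimpleGraph X}
    {a : W → W → Prop} {φ : X → W} (hinj : Function.Injective φ)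
    (hφ : ∀ x y, G.Adj x y → a (φ x) (φ y)) (m : ℕ) {c p : X} {b q : W} (hb : a b (φ c))
    (hq : a (φ p) q) :
    {P : G.Walk c p | P.IsPath ∧ P.length = 2 * m + 1}.ncard ≤
      Nat.card {r : Fin m → W × W // IsLeg a (b, φ c) r (φ p, q)} := by
  have hleg : ∀ P : G.Walk c p, P.length = 2 * m + 1 → IsLeg a (b, φ c)
      (fun i : Fin m => (φ (P.getVert (2 * i + 1)), φ (P.getVert (2 * i + 2)))) (φ p, q) := by
    intro P hP
    set e := endSeq (b, φ c)
      (fun i : Fin m => (φ (P.getVert (2 * i + 1)), φ (P.getVert (2 * i + 2)))) (φ p, q) with he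
    have hadj : ∀ i < 2 * m + 1, a (φ (P.getVert i)) (φ (P.getVert (i + 1))) :=
      fun i hi => hφ _ _ (P.adj_getVert_succ (by omega))
    have h2 : ∀ i ≤ m, (e i).2 = φ (P.getVert (2 * i)) := by
      rintro (_ | i) hi
      · simp [he, endSeq]
      · rw [he, endSeq_succ_of_lt (by omega)]
        rfl
    have h1 : ∀ i ≤ m, (e (i + 1)).1 = φ (P.getVert (2 * i + 1)) := by
      intro i hi
      rcases hi.lt_or_eq with h | rfl
      · rw [he, endSeq_succ_of_lt h]
      · rw [he, endSeq_last, ← hP, P.getVert_length]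
    have h12 : ∀ i ≤ m + 1, a (e i).1 (e i).2 := by
      rintro (_ | i) hi
      · exact hb
      · rcases (show i ≤ m by omega).lt_or_eq with h | rfl
        · rw [h1 i (by omega), h2 (i + 1) (by omega)]
          exact hadj _ (by omega)
        · rw [he, endSeq_last]
          exact hq
    intro i hi
    refine ⟨h12 i (by omega), ?_, h12 (i + 1) (by omega)⟩
    rw [h1 i hi, h2 i hi]
    exact hadj _ (by omega)
  refine Nat.card_le_card_of_injective
    (fun P : {P : G.Walk c p | P.IsPath ∧ P.length = 2 * m + 1} => ⟨_, hleg P.1 P.2.2⟩) ?_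
  rintro ⟨P, hP⟩ ⟨P', hP'⟩ h
  have h' := Subtype.ext_iff.1 h
  refine Subtype.ext (SimpleGraph.Walk.ext_getVert_le_length (hP.2.trans hP'.2.symm) ?_)
  intro i hi
  rw [hP.2] at hi
  rcases Nat.eq_zero_or_pos i with rfl | h0
  · simp
  rcases hi.lt_or_eq with h1 | h1
  · have h2 := congrFun h' ⟨(i - 1) / 2, by omega⟩
    simp only [Prod.mk.injEq] at h2
    rcases Nat.even_or_odd' i with ⟨j, rfl | rfl⟩
    · have h3 := hinj h2.2
      rwa [show 2 * ((2 * j - 1) / 2) + 2 = 2 * j by omega] at h3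
    · have h3 := hinj h2.1
      rwa [show 2 * ((2 * j + 1 - 1) / 2) + 1 = 2 * j + 1 by omega] at h3
  · exact (P.getVert_of_length_le (hP.2.trans h1.symm).le).trans
      (P'.getVert_of_length_le (hP'.2.trans h1.symm).le).symm

/-- A graph has at least twice as many ordered pairs of adjacent vertices as edges. -/
theorem two_mul_ncard_edgeSet_le {W : Type*} [Finite W] (G : SimpleGraph W) :
    2 * G.edgeSet.ncard ≤ Nat.card {e : W × W // G.Adj e.1 e.2} := by
  classical
  have := Fintype.ofFinite W
  rw [← SimpleGraph.coe_edgeFinset G, Set.ncard_coe_finset, ← G.dart_card_eq_twice_card_edges,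
    ← Nat.card_eq_fintype_card]
  exact Nat.card_le_card_of_injective (fun d : G.Dart => ⟨d.toProd, d.adj⟩)
    fun d d' h => SimpleGraph.Dart.ext _ _ (Subtype.ext_iff.1 h)

end Walks

/-! ### Located robust subgraphs -/

section Located

variable {V : Type u} {U : Finset V} {G : SimpleGraph V} {S S' : G.Subgraph} {α μ β : ℝ} {ℓ : ℕ}

theorem natCard_mem_verts (hS : S.verts ⊆ (U : Set V)) :
    Nat.card {w : U // w.1 ∈ S.verts} = S.verts.ncard :=
  Nat.card_congr
    { toFun := fun w => ⟨w.1.1, w.2⟩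
      invFun := fun w => ⟨⟨w.1, hS w.2⟩, w.2⟩
      left_inv := fun _ => rfl
      right_inv := fun _ => rfl }

theorem two_mul_ncard_subgraph_edgeSet_le (hS : S.verts ⊆ (U : Set V)) :
    2 * S.edgeSet.ncard ≤ Nat.card {e : U × U // S.Adj e.1 e.2} := by
  let G' : SimpleGraph U := S.spanningCoe.comap Subtype.val
  have h1 : S.edgeSet.ncard ≤ G'.edgeSet.ncard := by
    refine (Set.ncard_le_ncard (t := Sym2.map Subtype.val '' G'.edgeSet) ?_
      ((Set.toFinite _).image _)).trans (Set.ncard_image_le (Set.toFinite _))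
    intro e
    induction e using Sym2.ind with
    | _ x y =>
      intro h
      have h' : S.Adj x y := h
      exact ⟨s(⟨x, hS h'.fst_mem⟩, ⟨y, hS h'.snd_mem⟩), h', rfl⟩
  exact (Nat.mul_le_mul_left 2 h1).trans (two_mul_ncard_edgeSet_le G')

theorem natCard_pair_subtype {W : Type*} [Finite W] (P : W → Prop) :
    Nat.card {e : W × W // P e.1 ∧ P e.2} = Nat.card {w // P w} ^ 2 := by
  rw [sq, ← Nat.card_prod]
  exact Nat.card_congr
    { toFun := fun e => (⟨e.1.1, e.2.1⟩, ⟨e.1.2, e.2.2⟩)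
      invFun := fun e => ⟨(e.1.1, e.2.1), e.1.2, e.2.2⟩
      left_inv := fun _ => rfl
      right_inv := fun _ => rfl }

theorem natCard_subtype_add_not {W : Type*} [Finite W] (P : W → Prop) :
    Nat.card {w // P w} + Nat.card {w // ¬ P w} = Nat.card W := by
  classical
  rw [← Nat.card_sum]
  exact Nat.card_congr (Equiv.sumCompl P)

theorem natCard_and_add_and_not {W : Type*} [Finite W] (P Q : W → Prop) :
    Nat.card {w // P w ∧ Q w} + Nat.card {w // P w ∧ ¬ Q w} = Nat.card {w // P w} := by
  rw [← natCard_subtype_add_not (fun w : {w // P w} => Q w.1)]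
  congr 1
  · exact Nat.card_congr (Equiv.subtypeSubtypeEquivSubtypeInter P Q).symm
  · exact Nat.card_congr (Equiv.subtypeSubtypeEquivSubtypeInter P fun w => ¬ Q w).symm

/-- Inside its vertex set, a located robust subgraph misses few ordered pairs. -/
theorem IsLocatedRobustSubgraph.natCard_not_adj_le
    (h : IsLocatedRobustSubgraph U G S α μ β ℓ) :
    (Nat.card {e : U × U // (e.1.1 ∈ S.verts ∧ e.2.1 ∈ S.verts) ∧ ¬ S.Adj e.1 e.2} : ℝ) ≤
      (S.verts.ncard : ℝ) ^ 2 + (#U - S.verts.ncard : ℝ) ^ 2 - (5 / 9 + α / 2) * (#U : ℝ) ^ 2 := by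
  have h1 := natCard_and_add_and_not (fun e : U × U => e.1.1 ∈ S.verts ∧ e.2.1 ∈ S.verts)
    (fun e => S.Adj e.1 e.2)
  rw [natCard_pair_subtype (fun w : U => w.1 ∈ S.verts), natCard_mem_verts h.verts_subset] at h1
  have h2 : Nat.card {e : U × U // S.Adj e.1 e.2} ≤
      Nat.card {e : U × U // (e.1.1 ∈ S.verts ∧ e.2.1 ∈ S.verts) ∧ S.Adj e.1 e.2} :=
    natCard_subtype_le fun e he => ⟨⟨he.fst_mem, he.snd_mem⟩, he⟩
  have h3 := two_mul_ncard_subgraph_edgeSet_le h.verts_subset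
  have h4 := h.card_edges
  have h5 : (2 * S.edgeSet.ncard : ℝ) +
      Nat.card {e : U × U // (e.1.1 ∈ S.verts ∧ e.2.1 ∈ S.verts) ∧ ¬ S.Adj e.1 e.2} ≤
      (S.verts.ncard : ℝ) ^ 2 := by
    have : 2 * S.edgeSet.ncard +
      Nat.card {e : U × U // (e.1.1 ∈ S.verts ∧ e.2.1 ∈ S.verts) ∧ ¬ S.Adj e.1 e.2} ≤
      S.verts.ncard ^ 2 := by omega
    exact_mod_cast this
  linarith

/-- Any two located robust subgraphs on the same set `U` share many edges: if they have `s` and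
`s'` vertices, then at least `s + s' - |U|` vertices are common to both, and the numbers of ordered
pairs missed leave at least `(1/9 + α) |U|² - (s - s')²` common ordered pairs. -/
theorem IsLocatedRobustSubgraph.dens_common {G' : SimpleGraph V} {S' : G'.Subgraph}
    (hα : 0 < α) (h : IsLocatedRobustSubgraph U G S α μ β ℓ)
    (h' : IsLocatedRobustSubgraph U G' S' α μ β ℓ) :
    Dens α (fun e : U × U => S.Adj e.1 e.2 ∧ S'.Adj e.1 e.2) := by
  set n : ℝ := (#U : ℝ) with hn
  set s : ℝ := (S.verts.ncard : ℝ) with hs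
  set s' : ℝ := (S'.verts.ncard : ℝ) with hs'
  have hU : (Nat.card U : ℝ) = n := by rw [hn, Nat.card_eq_fintype_card, Fintype.card_coe]
  have hn0 : 0 ≤ n := Nat.cast_nonneg _
  have hm := h.natCard_not_adj_le
  have hm' := h'.natCard_not_adj_le
  have hsn : s ≤ n := by
    have := (natCard_mem_verts h.verts_subset).symm.le.trans (natCard_subtype_le_natCard _)
    rw [← hU, hs]
    exact_mod_cast this
  have hsn' : s' ≤ n := by
    have := (natCard_mem_verts h'.verts_subset).symm.le.trans (natCard_subtype_le_natCard _)
    rw [← hU, hs']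
    exact_mod_cast this
  have hc := h.card_verts
  have hc' := h'.card_verts
  set i : ℝ := (Nat.card {w : U // w.1 ∈ S.verts ∧ w.1 ∈ S'.verts} : ℝ) with hi
  have hinter : s + s' - n ≤ i := by
    have h1 := natCard_and_add_and_not (fun w : U => w.1 ∈ S.verts) (fun w => w.1 ∈ S'.verts)
    have h2 := natCard_subtype_add_not (fun w : U => w.1 ∈ S'.verts)
    have h3 : Nat.card {w : U // w.1 ∈ S.verts ∧ ¬ w.1 ∈ S'.verts} ≤
        Nat.card {w : U // ¬ w.1 ∈ S'.verts} := natCard_subtype_le fun w hw => hw.2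
    rw [natCard_mem_verts h.verts_subset] at h1
    rw [natCard_mem_verts h'.verts_subset] at h2
    have h4 : S.verts.ncard + S'.verts.ncard ≤
        Nat.card {w : U // w.1 ∈ S.verts ∧ w.1 ∈ S'.verts} + Nat.card U := by omega
    have h5 : s + s' ≤ i + n := by
      rw [← hU, hs, hs', hi]
      exact_mod_cast h4
    linarith
  have hcover : i ^ 2 ≤ Nat.card {e : U × U // S.Adj e.1 e.2 ∧ S'.Adj e.1 e.2} +
      (Nat.card {e : U × U // (e.1.1 ∈ S.verts ∧ e.2.1 ∈ S.verts) ∧ ¬ S.Adj e.1 e.2} +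
      Nat.card {e : U × U // (e.1.1 ∈ S'.verts ∧ e.2.1 ∈ S'.verts) ∧ ¬ S'.Adj e.1 e.2} : ℝ) := by
    have h1 := (natCard_pair_subtype (fun w : U => w.1 ∈ S.verts ∧ w.1 ∈ S'.verts)).symm.le.trans
      ((natCard_subtype_le_of_imp_or
        (Q := fun e : U × U => S.Adj e.1 e.2 ∧ S'.Adj e.1 e.2)
        (R := fun e : U × U => ((e.1.1 ∈ S.verts ∧ e.2.1 ∈ S.verts) ∧ ¬ S.Adj e.1 e.2) ∨
          ((e.1.1 ∈ S'.verts ∧ e.2.1 ∈ S'.verts) ∧ ¬ S'.Adj e.1 e.2))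
        fun e he => by tauto).trans (Nat.add_le_add_left (natCard_subtype_or_le _ _) _))
    rw [hi]
    exact_mod_cast h1
  unfold Dens
  rw [Nat.card_prod, Nat.cast_mul, hU]
  have hαn : 0 ≤ α * n := by positivity
  have hpos : 0 ≤ s + s' - n := by linarith
  have hsq : (s + s' - n) ^ 2 ≤ i ^ 2 := pow_le_pow_left₀ hpos hinter 2
  have hdiff : (s - s') ^ 2 ≤ (n / 3) ^ 2 :=
    sq_le_sq' (by linarith) (by linarith)
  linarith

/-- Few edges of `G` inside `U` do not belong to the located robust subgraph. -/
theorem IsLocatedRobustSubgraph.natCard_adj_and_not_adj_le (hα : 0 < α)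
    (h : IsLocatedRobustSubgraph U G S α μ β ℓ) :
    (Nat.card {e : U × U // G.Adj e.1 e.2 ∧ ¬ S.Adj e.1 e.2} : ℝ) ≤
      (1 / 9 + 2 * μ) * (#U : ℝ) ^ 2 := by
  have hfin : {e | e ∈ G.edgeSet ∧ ∃ a ∈ S.verts, ∃ b ∈ (U : Set V) \ S.verts,
      e = s(a, b)}.Finite := by
    refine ((U ×ˢ U).finite_toSet.image fun p => s(p.1, p.2)).subset ?_
    rintro e ⟨-, a, ha, b, hb, rfl⟩
    exact ⟨(a, b), by simpa using ⟨h.verts_subset ha, hb.1⟩, rfl⟩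
  have hcross : Nat.card {e : U × U // G.Adj e.1 e.2 ∧ e.1.1 ∈ S.verts ∧ e.2.1 ∉ S.verts} ≤
      numEdgesBetween G S.verts ((U : Set V) \ S.verts) := by
    have := hfin.to_subtype
    refine Nat.card_le_card_of_injective
      (fun e => ⟨s(e.1.1.1, e.1.2.1), e.2.1, _, e.2.2.1, _, ⟨e.1.2.2, e.2.2.2⟩, rfl⟩) ?_
    rintro ⟨⟨⟨a, ha⟩, ⟨b, hb⟩⟩, h1, h2, h3⟩ ⟨⟨⟨a', ha'⟩, ⟨b', hb'⟩⟩, h1', h2', h3'⟩ heq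
    have h4 := Subtype.ext_iff.1 heq
    simp only [Sym2.eq_iff] at h4
    rcases h4 with ⟨rfl, rfl⟩ | ⟨rfl, rfl⟩
    · rfl
    · exact absurd h2 h3'
  have hcross' : Nat.card {e : U × U // G.Adj e.1 e.2 ∧ e.2.1 ∈ S.verts ∧ e.1.1 ∉ S.verts} ≤
      numEdgesBetween G S.verts ((U : Set V) \ S.verts) := by
    rw [← natCard_subtype_equiv (Equiv.prodComm U U)]
    exact (natCard_subtype_le fun e he => ⟨he.1.symm, he.2⟩).trans hcross
  have hout := natCard_pair_subtype (fun w : U => ¬ w.1 ∈ S.verts)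
  have hcount := (natCard_subtype_le_of_imp_or
    (P := fun e : U × U => G.Adj e.1 e.2 ∧ ¬ S.Adj e.1 e.2)
    (Q := fun e : U × U => ¬ e.1.1 ∈ S.verts ∧ ¬ e.2.1 ∈ S.verts)
    (R := fun e : U × U => (G.Adj e.1 e.2 ∧ e.1.1 ∈ S.verts ∧ e.2.1 ∉ S.verts) ∨
      (G.Adj e.1 e.2 ∧ e.2.1 ∈ S.verts ∧ e.1.1 ∉ S.verts))
    fun e he => by
      have : e.1.1 ∈ S.verts → e.2.1 ∈ S.verts → S.Adj e.1 e.2 :=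
        fun h1 h2 => h.isInduced h1 h2 he.1
      tauto).trans (Nat.add_le_add_left (natCard_subtype_or_le _ _) _)
  have hcompl := natCard_subtype_add_not (fun w : U => w.1 ∈ S.verts)
  rw [natCard_mem_verts h.verts_subset, Nat.card_eq_fintype_card (α := U), Fintype.card_coe]
    at hcompl
  rw [hout] at hcount
  set o := Nat.card {w : U // ¬ w.1 ∈ S.verts} with ho
  have ho' : (o : ℝ) ≤ #U / 3 := by
    have h1 := h.card_verts
    have h2 : (S.verts.ncard : ℝ) + o = #U := by exact_mod_cast hcompl
    nlinarith [(Nat.cast_nonneg #U : (0 : ℝ) ≤ #U)]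
  have h3 : (Nat.card {e : U × U // G.Adj e.1 e.2 ∧ ¬ S.Adj e.1 e.2} : ℝ) ≤
      (o : ℝ) ^ 2 + 2 * numEdgesBetween G S.verts ((U : Set V) \ S.verts) := by
    have : Nat.card {e : U × U // G.Adj e.1 e.2 ∧ ¬ S.Adj e.1 e.2} ≤
      o ^ 2 + 2 * numEdgesBetween G S.verts ((U : Set V) \ S.verts) := by omega
    exact_mod_cast this
  have h4 := h.cross_edges
  have h5 : (o : ℝ) ^ 2 ≤ (#U / 3 : ℝ) ^ 2 := pow_le_pow_left₀ (Nat.cast_nonneg _) ho' 2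
  nlinarith

theorem IsLocatedRobustSubgraph.dens_adj (hα : 0 < α)
    (h : IsLocatedRobustSubgraph U G S α μ β ℓ) :
    Dens (4 / 9) (fun e : U × U => S.Adj e.1 e.2) := by
  have h1 : (2 * S.edgeSet.ncard : ℝ) ≤ Nat.card {e : U × U // S.Adj e.1 e.2} := by
    exact_mod_cast two_mul_ncard_subgraph_edgeSet_le h.verts_subset
  have h2 := h.card_edges'.trans h.card_edges
  unfold Dens
  rw [Nat.card_prod, Nat.card_eq_fintype_card (α := U), Fintype.card_coe, Nat.cast_mul]
  nlinarith [sq_nonneg (#U : ℝ)]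

/-- Robustness, as a statement on the density of legs. -/
theorem IsLocatedRobustSubgraph.dens_legs {m : ℕ} (hα : 0 < α) (hβ : 0 < β)
    (h : IsLocatedRobustSubgraph U G S α μ β (2 * m + 1)) {b c p q : U} (hbc : S.Adj b c)
    (hpq : S.Adj p q) (hcp : c ≠ p) :
    Dens (β * (2 / 3) ^ (2 * m))
      (fun r : Fin m → U × U => IsLeg (fun x y : U => S.Adj x y) (b, c) r (p, q)) := by
  have h1 := h.robust ⟨c, hbc.snd_mem⟩ ⟨p, hpq.fst_mem⟩
    (fun h => hcp (Subtype.ext (Subtype.mk.inj h)))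
  have h2 := ncard_paths_le_natCard_legs (G := S.coe) (a := fun x y : U => S.Adj x y)
    (φ := fun x => ⟨x.1, h.verts_subset x.2⟩)
    (fun x y hxy => Subtype.ext (Subtype.mk.inj hxy)) (fun x y hxy => hxy) m
    (c := ⟨c, hbc.snd_mem⟩) (p := ⟨p, hpq.fst_mem⟩) (b := b) (q := q) hbc hpq
  have h3 : (Nat.card S.verts : ℝ) = S.verts.ncard := rfl
  rw [h3, Nat.add_sub_cancel] at h1
  refine le_trans ?_ (h1.trans (by exact_mod_cast h2))
  rw [Nat.card_fun, Nat.card_prod, Nat.card_fin, Nat.card_eq_fintype_card (α := U),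
    Fintype.card_coe]
  have h4 := h.card_verts
  have h5 : (2 / 3 * #U : ℝ) ^ (2 * m) ≤ (S.verts.ncard : ℝ) ^ (2 * m) :=
    pow_le_pow_left₀ (by positivity)
      (by nlinarith [(Nat.cast_nonneg #U : (0 : ℝ) ≤ #U)]) _
  calc _ = β * (2 / 3 * #U : ℝ) ^ (2 * m) := by push_cast; ring
    _ ≤ _ := mul_le_mul_of_nonneg_left h5 hβ.le

end Located

/-! ### The link system of a 4-uniform setup -/

theorem ncard_mem_and_le_natCard {V : Type*} {U : Finset V} {P : V → Prop} {Q : U → Prop}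
    (h : ∀ v : U, P v → Q v) : {v | v ∈ U ∧ P v}.ncard ≤ Nat.card {v // Q v} :=
  Nat.card_le_card_of_injective
    (fun v : {v | v ∈ U ∧ P v} => (⟨⟨v.1, v.2.1⟩, h ⟨v.1, v.2.1⟩ v.2.2⟩ : {v // Q v}))
    fun _ _ hvw => Subtype.ext (congrArg (fun t : {v // Q v} => (t.1 : V)) hvw)

section System

variable {V : Type u} [DecidableEq V]

/-- The edge relation of a `4`-uniform hypergraph on the type of its vertices. -/
def edgeRel (H : UniformHypergraph V 4) (a b c d : H.verts) : Prop :=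
  ({a.1, b.1, c.1, d.1} : Finset V) ∈ H.edges

/-- The adjacency relation of the subgraph `R` of the link of `uv`, on the type of vertices. -/
def adjRel (H : UniformHypergraph V 4) (R : ∀ p : Sym2 V, (H.pairLink p).Subgraph)
    (u v x y : H.verts) : Prop :=
  (R s(u.1, v.1)).Adj x y

variable {H : UniformHypergraph V 4} {R : ∀ p : Sym2 V, (H.pairLink p).Subgraph} {α β : ℝ} {m : ℕ}

theorem edgeRel_of_adjRel {u v x y : H.verts} (h : adjRel H R u v x y) : edgeRel H u v x y :=
  (H.pairLink_adj u v x y).1 h.adj_sub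

theorem edgeRel_swap {a b c d : H.verts} (h : edgeRel H a b c d) : edgeRel H b a c d := by
  unfold edgeRel at *
  rwa [Finset.insert_comm]

theorem edgeRel_rotate {a b c d : H.verts} (h : edgeRel H a b c d) : edgeRel H b c d a := by
  unfold edgeRel at *
  convert h using 1
  ext w
  simp only [Finset.mem_insert, Finset.mem_singleton]
  tauto

theorem edgeRel_ne {a b c d : H.verts} (h : edgeRel H a b c d) : a ≠ b := by
  rintro rfl
  have h1 := H.card_eq _ h
  have h2 : #({a.1, a.1, c.1, d.1} : Finset V) ≤ 3 := by
    rw [Finset.insert_eq_of_mem (Finset.mem_insert_self _ _)]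
    exact Finset.card_le_three
  omega

/-- For every vertex `v` there are many triples `pqr` with `pq ∈ R_{rv}` and `qr ∈ R_{pv}`, and in
most of them `pq` and `qr` belong to many of the graphs `R_{uv}`. -/
theorem IsFourUniformSetup.dens_bridges {ℓ : ℕ} (hα : 0 < α) (hα' : α < 1 / 3)
    (h : IsFourUniformSetup α β ℓ H R) (hn : 4 ≤ #H.verts) (v : H.verts) :
    Dens (1 / 12) (fun e : H.verts × H.verts × H.verts => edgeRel H v e.1 e.2.1 e.2.2 ∧
      Dens (1 / 24) (fun u => adjRel H R u v e.1 e.2.1) ∧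
      Dens (1 / 24) (fun u => adjRel H R u v e.2.1 e.2.2)) := by
  have hcard : Nat.card H.verts = #H.verts := by rw [Nat.card_eq_fintype_card, Fintype.card_coe]
  have hn' : (4 : ℝ) ≤ #H.verts := by exact_mod_cast hn
  have hloc : ∀ u w : H.verts, u ≠ w → IsLocatedRobustSubgraph H.verts (H.pairLink s(u.1, w.1))
      (R s(u.1, w.1)) α (α ^ 3 / 18) β ℓ :=
    fun u w huw => h.located u u.2 w w.2 fun h => huw (Subtype.ext h)
  have h1 : Dens (3 / 4) (fun r : H.verts => r ≠ v) := by
    have h2 : Nat.card {r : H.verts // True ∧ ¬ r ≠ v} = 1 := by simp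
    have h3 : Dens (1 : ℝ) (fun _ : H.verts => True) := by
      unfold Dens
      rw [one_mul, Nat.card_congr (Equiv.subtypeUnivEquiv fun _ => trivial)]
    refine (h3.and_of_card_le (d := 1 / 4) ?_).mono_const (by norm_num) |>.mono fun r hr => hr.2
    rw [h2, hcard]
    push_cast
    linarith
  -- The triples `(p, q, r)` with `pq ∈ R_{rv}` have density at least `3 / 4 * 4 / 9 = 1 / 3`.
  have h2 := h1.prod (d := 4 / 9) (by norm_num) fun r hr => (hloc r v hr).dens_adj hα
  have h3 := h2.of_equiv (Q := fun e : H.verts × H.verts × H.verts =>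
      e.2.2 ≠ v ∧ adjRel H R e.2.2 v e.1 e.2.1)
    ⟨fun e => (e.2.1, e.2.2, e.1), fun e => (e.2.2, e.1, e.2.1), fun _ => rfl, fun _ => rfl⟩
    fun _ => Iff.rfl
  -- In few of them `qr` is an edge of the link of `pv` outside `R_{pv}`.
  have h4 : (Nat.card {e : H.verts × H.verts × H.verts //
      (e.2.2 ≠ v ∧ adjRel H R e.2.2 v e.1 e.2.1) ∧ ¬ adjRel H R e.1 v e.2.1 e.2.2} : ℝ) ≤
      (1 / 9 + 2 * (α ^ 3 / 18)) * Nat.card (H.verts × H.verts × H.verts) := by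
    rw [natCard_subtype_prod]
    push_cast
    have h5 : ∀ p : H.verts, (Nat.card {e : H.verts × H.verts // (e.2 ≠ v ∧
        adjRel H R e.2 v p e.1) ∧ ¬ adjRel H R p v e.1 e.2} : ℝ) ≤
        (1 / 9 + 2 * (α ^ 3 / 18)) * (#H.verts : ℝ) ^ 2 := by
      intro p
      by_cases hp : p = v
      · have : IsEmpty {e : H.verts × H.verts // (e.2 ≠ v ∧ adjRel H R e.2 v p e.1) ∧
            ¬ adjRel H R p v e.1 e.2} := by
          refine ⟨fun e => ?_⟩
          exact edgeRel_ne (edgeRel_rotate (edgeRel_of_adjRel e.2.1.2)) hp.symm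
        rw [Nat.card_of_isEmpty, Nat.cast_zero]
        positivity
      · refine le_trans ?_ ((hloc p v hp).natCard_adj_and_not_adj_le hα)
        exact_mod_cast natCard_subtype_le (P := fun e : H.verts × H.verts =>
          (e.2 ≠ v ∧ adjRel H R e.2 v p e.1) ∧ ¬ adjRel H R p v e.1 e.2)
          (Q := fun e : H.verts × H.verts => (H.pairLink s(p.1, v.1)).Adj e.1.1 e.2.1 ∧
            ¬ (R s(p.1, v.1)).Adj e.1.1 e.2.1)
          fun e he => ⟨(H.pairLink_adj ..).2 (edgeRel_swap (edgeRel_rotate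
            (edgeRel_of_adjRel he.1.2))), he.2⟩
    refine (Finset.sum_le_sum fun p _ => h5 p).trans (le_of_eq ?_)
    rw [Finset.sum_const, nsmul_eq_mul, Finset.card_univ, Nat.card_prod, Nat.card_prod, hcard,
      Fintype.card_coe]
    push_cast
    ring
  have hα3 : α ^ 3 ≤ (1 / 3) ^ 3 := pow_le_pow_left₀ hα.le hα'.le 3
  have h5 := (h3.and_of_card_le h4).mono_const (d := 1 / 6) (by linarith)
  -- Discard the triples in which `pq`, and then those in which `qr`, lies in few graphs `R_{uv}`.
  have h6 := (h5.of_equiv (Q := fun e : (H.verts × H.verts) × H.verts =>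
      adjRel H R e.2 v e.1.1 e.1.2 ∧ adjRel H R e.1.1 v e.1.2 e.2)
    ⟨fun e => ((e.1, e.2.1), e.2.2), fun e => (e.1.1, e.1.2, e.2), fun _ => rfl, fun _ => rfl⟩
    fun e => ⟨fun h => ⟨h.1.2, h.2⟩, fun h => ⟨⟨edgeRel_ne (edgeRel_of_adjRel h.1), h.1⟩, h.2⟩⟩)
  have h7 := h6.remove (ε := 1 / 24) (by norm_num)
    (Q := fun e : (H.verts × H.verts) × H.verts => adjRel H R e.2 v e.1.1 e.1.2) fun e he => he.1
  have h8 := h7.of_equiv (Q := fun e : (H.verts × H.verts) × H.verts =>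
      (adjRel H R e.1.2 v e.2 e.1.1 ∧ adjRel H R e.2 v e.1.1 e.1.2) ∧
        Dens (1 / 24) (fun u => adjRel H R u v e.2 e.1.1))
    ⟨fun e => ((e.1.2, e.2), e.1.1), fun e => ((e.2, e.1.1), e.1.2), fun _ => rfl, fun _ => rfl⟩
    fun _ => Iff.rfl
  have h9 := h8.remove (ε := 1 / 24) (by norm_num)
    (Q := fun e : (H.verts × H.verts) × H.verts => adjRel H R e.2 v e.1.1 e.1.2)
    fun e he => he.1.2
  have h10 := h9.of_equiv (Q := fun e : H.verts × H.verts × H.verts =>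
      ((adjRel H R e.2.2 v e.1 e.2.1 ∧ adjRel H R e.1 v e.2.1 e.2.2) ∧
        Dens (1 / 24) (fun u => adjRel H R u v e.1 e.2.1)) ∧
        Dens (1 / 24) (fun u => adjRel H R u v e.2.1 e.2.2))
    ⟨fun e => (e.2, e.1.1, e.1.2), fun e => ((e.2.1, e.2.2), e.1), fun _ => rfl, fun _ => rfl⟩
    fun _ => Iff.rfl
  exact (h10.mono_const (by norm_num)).mono fun e he =>
    ⟨edgeRel_rotate (edgeRel_of_adjRel he.1.1.1), he.1.2, he.2⟩

/-- The edge relation and the robust subgraphs of a setup form a link system.  The factor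
`(2 / 3) ^ (2 m)` converts densities in the vertex set of a robust subgraph to densities in the
whole vertex set. -/
theorem IsFourUniformSetup.isLinkSystem (hα : 0 < α) (hα' : α < 1 / 3) (hβ : 0 < β)
    (h : IsFourUniformSetup α β (2 * m + 1) H R) (hn : 4 ≤ #H.verts) :
    IsLinkSystem (edgeRel H) (adjRel H R) m α (β * (2 / 3) ^ (2 * m)) (1 / 24) where
  edge_swap := edgeRel_swap
  edge_rotate := edgeRel_rotate
  edge_ne := edgeRel_ne
  edge_of_adj := edgeRel_of_adjRel
  adj_comm := by
    intro u v x y hA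
    unfold adjRel at *
    rwa [Sym2.eq_swap]
  common := fun {u v w} huv hwv =>
    (h.located u u.2 v v.2 fun h => huv (Subtype.ext h)).dens_common hα
      (h.located w w.2 v v.2 fun h => hwv (Subtype.ext h))
  legs := fun {u v b c p q} hbc hpq hcp =>
    (h.located u u.2 v v.2 fun h =>
      edgeRel_ne (edgeRel_of_adjRel hbc) (Subtype.ext h)).dens_legs hα hβ hbc hpq hcp
  triples := by
    have : Nonempty H.verts := by
      obtain ⟨x, hx⟩ := Finset.card_pos.1 (lt_of_lt_of_le (by norm_num) hn)
      exact ⟨⟨x, hx⟩⟩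
    have h1 : Dens (1 : ℝ) (fun _ : H.verts => True) := by
      unfold Dens
      rw [one_mul, Nat.card_congr (Equiv.subtypeUnivEquiv fun _ => trivial)]
    have h2 := h1.prod (by norm_num) fun v _ => h.dens_bridges hα hα' hn v
    have h3 := (h2.of_equiv (Equiv.prodComm _ _) (Q := fun e :
        (H.verts × H.verts × H.verts) × H.verts => True ∧ edgeRel H e.2 e.1.1 e.1.2.1 e.1.2.2 ∧
      Dens (1 / 24) (fun u => adjRel H R u e.2 e.1.1 e.1.2.1) ∧
      Dens (1 / 24) (fun u => adjRel H R u e.2 e.1.2.1 e.1.2.2)) fun _ => Iff.rfl).markov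
        (by norm_num)
    refine (h3.mono_const (by norm_num)).mono fun e he => ?_
    exact (he.mono_const (by norm_num)).mono fun v hv => hv.2

/-- Connectability in `H`, expressed by densities; the factor `1 / 2` accounts for the vertex
that is deleted from a link. -/
theorem connTriple_of_isConnectableTriple {ζ : ℝ} (hζ : 0 < ζ) (hn : 2 ≤ #H.verts) {x y z : V}
    (h : H.IsConnectableTriple R ζ x y z) :
    ConnTriple (edgeRel H) (adjRel H R) (ζ / 2) ⟨x, h.1⟩ ⟨y, h.2.1⟩ ⟨z, h.2.2.1⟩ := by
  have hcard : (Nat.card H.verts : ℝ) = #H.verts := by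
    rw [Nat.card_eq_fintype_card, Fintype.card_coe]
  have hn' : (2 : ℝ) ≤ #H.verts := by exact_mod_cast hn
  have hpair : ∀ (v : H.verts) {p q : V} (hp : p ∈ H.verts) (hq : q ∈ H.verts),
      (H.reducedLink v).IsConnectablePair (fun w => (R s(w, v.1)).spanningCoe) ζ p q →
      Dens (ζ / 2) (fun u => adjRel H R u v ⟨p, hp⟩ ⟨q, hq⟩) := by
    intro v p q hp hq hpq
    have h1 := hpq.2.2.2
    have h2 : (H.reducedLink v).order = #H.verts - 1 := by
      have : (H.reducedLink v).verts = H.verts.erase v := rfl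
      rw [UniformHypergraph.order, this, Finset.card_erase_of_mem v.2, Nat.cast_sub (by omega),
        Nat.cast_one]
    have h3 : {w | w ∈ (H.reducedLink v).verts ∧ (R s(w, v.1)).spanningCoe.Adj p q}.ncard ≤
        Nat.card {u // adjRel H R u v ⟨p, hp⟩ ⟨q, hq⟩} := by
      refine le_trans (Set.ncard_le_ncard (t := {w | w ∈ H.verts ∧ (R s(w, v.1)).Adj p q}) ?_ ?_)
        (ncard_mem_and_le_natCard fun w hw => hw)
      · rintro w ⟨hw, hA⟩
        exact ⟨Finset.mem_of_mem_erase hw, hA⟩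
      · exact H.verts.finite_toSet.subset fun w hw => hw.1
    unfold Dens
    rw [hcard]
    rw [h2] at h1
    have h4 := h1.trans (Nat.cast_le.2 h3)
    nlinarith
  have h1 := h.2.2.2
  have h2 := ncard_mem_and_le_natCard (U := H.verts)
    (P := fun v => (H.reducedLink v).IsBridge (fun w => (R s(w, v)).spanningCoe) ζ x y z)
    (Q := fun v : H.verts => edgeRel H v ⟨x, h.1⟩ ⟨y, h.2.1⟩ ⟨z, h.2.2.1⟩ ∧
      Dens (ζ / 2) (fun u => adjRel H R u v ⟨x, h.1⟩ ⟨y, h.2.1⟩) ∧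
      Dens (ζ / 2) (fun u => adjRel H R u v ⟨y, h.2.1⟩ ⟨z, h.2.2.1⟩))
    fun v hv => ⟨((H.mem_edges_reducedLink v _).1 hv.1).2, hpair v _ _ hv.2.1, hpair v _ _ hv.2.2⟩
  refine Dens.mono_const (c := ζ) ?_ (by linarith)
  change ζ * (Nat.card H.verts : ℝ) ≤ _
  rw [hcard]
  exact h1.trans (Nat.cast_le.2 h2)

end System

/-! ### From walks to paths: existence of connecting constants -/

section Paths

theorem ncard_setOf_length_eq (W : Type*) [Finite W] (l : ℕ) :
    {q : List W | q.length = l}.ncard = Nat.card W ^ l := by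
  have := Fintype.ofFinite W
  have h := card_vector (α := W) l
  rw [← Nat.card_eq_fintype_card, ← Nat.card_eq_fintype_card] at h
  exact h

/-- Embeddings of `Fin l` into the complement of `F` provide lists without repetitions. -/
theorem descFactorial_le_ncard_nodup {W : Type*} [Finite W] (F : Finset W) (l : ℕ) :
    (Nat.card W - #F).descFactorial l ≤
      {q : List W | q.length = l ∧ q.Nodup ∧ ∀ w ∈ q, w ∉ F}.ncard := by
  classical
  have := Fintype.ofFinite W
  have h1 : Fintype.card (Fin l ↪ {w // w ∉ F}) = (Nat.card W - #F).descFactorial l := by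
    rw [Fintype.card_embedding_eq, Fintype.card_fin, Fintype.card_subtype_compl,
      Nat.card_eq_fintype_card, Fintype.card_coe]
  have hfin : Finite {q : List W | q.length = l ∧ q.Nodup ∧ ∀ w ∈ q, w ∉ F} :=
    (List.finite_length_eq W l).subset fun _ h => h.1
  rw [← h1, ← Nat.card_eq_fintype_card]
  refine Nat.card_le_card_of_injective (fun e => ⟨List.ofFn fun i => (e i).1, ?_, ?_, ?_⟩) ?_
  · simp
  · exact List.nodup_ofFn.2 (Subtype.val_injective.comp e.injective)
  · intro w hw
    obtain ⟨i, rfl⟩ := (List.mem_ofFn' _ _).1 hw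
    exact (e i).2
  · intro e e' h
    have h2 := List.ofFn_injective (Subtype.ext_iff.1 h)
    exact DFunLike.ext _ _ fun i => Subtype.ext (congrFun h2 i)

/-- In a large set, a dense set of lists contains many lists that have distinct entries and avoid
a given small set. -/
theorem half_le_ncard_nodup {W : Type*} [Finite W] {A : Set (List W)} {l : ℕ} {θ : ℝ}
    (hA : ∀ q ∈ A, q.length = l) (F : Finset W) (hF : #F ≤ 6)
    (hn : l + 6 ≤ Nat.card W) (hθ : 2 * l * (l + 5) ≤ θ * Nat.card W)
    (h : θ * (Nat.card W : ℝ) ^ l ≤ (A.ncard : ℝ)) :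
    θ / 2 * (Nat.card W : ℝ) ^ l ≤ ({q | q ∈ A ∧ q.Nodup ∧ ∀ w ∈ q, w ∉ F}.ncard : ℝ) := by
  set n := Nat.card W with hn'
  set B : Set (List W) := {q | q.length = l ∧ q.Nodup ∧ ∀ w ∈ q, w ∉ F} with hB
  have hfin := List.finite_length_eq W l
  have h1 : (n - (l + 5)) ^ l ≤ B.ncard := by
    refine le_trans ?_ ((Nat.pow_sub_le_descFactorial (n - #F) l).trans
      (descFactorial_le_ncard_nodup F l))
    exact Nat.pow_le_pow_left (by omega) l
  have h2 : A.ncard + B.ncard ≤ n ^ l + {q | q ∈ A ∧ q.Nodup ∧ ∀ w ∈ q, w ∉ F}.ncard := by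
    rw [← Set.ncard_union_add_ncard_inter A B (hfin.subset hA) (hfin.subset fun _ h => h.1),
      ← ncard_setOf_length_eq]
    refine Nat.add_le_add (Set.ncard_le_ncard ?_ hfin) (Set.ncard_le_ncard ?_ ?_)
    · exact Set.union_subset hA fun _ h => h.1
    · exact fun q hq => ⟨hq.1, hq.2.2⟩
    · exact hfin.subset fun q hq => hA q hq.1
  have hn0 : (0 : ℝ) < n := by
    have : 0 < n := by omega
    exact_mod_cast this
  -- Bernoulli's inequality bounds the number of excluded lists.
  have h3 : (1 - θ / 2) * (n : ℝ) ^ l ≤ ((n - (l + 5) : ℕ) : ℝ) ^ l := by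
    have h4 : ((n - (l + 5) : ℕ) : ℝ) = (1 + -((l + 5) / n : ℝ)) * n := by
      rw [Nat.cast_sub (by omega)]
      push_cast
      field_simp
      ring
    have h5 : ((l + 5) / n : ℝ) ≤ 1 := by
      rw [div_le_one hn0]
      have : l + 5 ≤ n := by omega
      exact_mod_cast this
    have h6 := one_add_mul_le_pow (a := -((l + 5) / n : ℝ)) (by linarith) l
    rw [h4, mul_pow]
    refine mul_le_mul_of_nonneg_right (le_trans ?_ h6) (by positivity)
    have h7 : (l : ℝ) * ((l + 5) / n) ≤ θ / 2 := by
      rw [← mul_div_assoc, div_le_iff₀ hn0]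
      linarith
    linarith
  have h8 : ((n - (l + 5) : ℕ) : ℝ) ^ l ≤ (B.ncard : ℝ) := by exact_mod_cast h1
  have h9 : (A.ncard + B.ncard : ℝ) ≤
      (n : ℝ) ^ l + {q | q ∈ A ∧ q.Nodup ∧ ∀ w ∈ q, w ∉ F}.ncard := by exact_mod_cast h2
  linarith

end Paths

section ConnectingPaths

variable {V : Type u} [DecidableEq V] {H : UniformHypergraph V 4}
  {R : ∀ p : Sym2 V, (H.pairLink p).Subgraph}

theorem finite_connectingPaths (H : UniformHypergraph V 4) (a b c x y z : V) (l : ℕ) :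
    (H.connectingPaths a b c x y z l).Finite := by
  refine ((List.finite_length_eq H.verts l).image (List.map Subtype.val)).subset ?_
  rintro q ⟨hq, -, hv, -⟩
  have hv' : ∀ v ∈ q, v ∈ H.verts := fun v h => hv v (by simp [h])
  lift q to List H.verts using hv'
  exact ⟨q, by simpa using hq, rfl⟩

/-- Any four consecutive entries of a tight walk form an edge of the hypergraph. -/
theorem tight_edgeRel_infix {L : List H.verts} (h : Tight (edgeRel H) L) {t : List V}
    (ht : t <:+: L.map Subtype.val) (h4 : t.length = 4) : t.toFinset ∈ H.edges := by
  obtain ⟨t', ht', rfl⟩ := List.infix_map_iff.1 ht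
  rw [List.length_map] at h4
  obtain ⟨a, b, c, d, rfl⟩ : ∃ a b c d, t' = [a, b, c, d] := by
    match t', h4 with
    | [a, b, c, d], _ => exact ⟨a, b, c, d, rfl⟩
  have := tight_infix h ht'
  unfold edgeRel at this
  simpa using this

theorem ConnTriple.nodup {ζ : ℝ} (hζ : 0 < ζ) {A : H.verts → H.verts → H.verts → H.verts → Prop}
    {a b c : H.verts} (h : ConnTriple (edgeRel H) A ζ a b c) : [a.1, b.1, c.1].Nodup := by
  have : Nonempty H.verts := ⟨a⟩
  obtain ⟨v, hv, -⟩ := Dens.exists_of_pos hζ h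
  have h1 := edgeRel_ne (edgeRel_rotate hv)
  have h2 := edgeRel_ne (edgeRel_rotate (edgeRel_rotate hv))
  have h3 := edgeRel_ne (edgeRel_rotate (edgeRel_swap (edgeRel_rotate hv)))
  simp only [List.nodup_cons, List.mem_cons, List.not_mem_nil, or_false, not_or, not_false_eq_true,
    List.nodup_nil, and_true]
  exact ⟨⟨fun h => h1 (Subtype.ext h), fun h => h3 (Subtype.ext h)⟩, fun h => h2 (Subtype.ext h)⟩

/-- Most of the walks between two disjoint triples are paths. -/
theorem half_le_ncard_connectingPaths {l : ℕ} {θ ζ : ℝ} (hζ : 0 < ζ)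
    {A : H.verts → H.verts → H.verts → H.verts → Prop} {a b c x y z : H.verts}
    (habc : ConnTriple (edgeRel H) A ζ a b c) (hxyz : ConnTriple (edgeRel H) A ζ x y z)
    (hdisj : Disjoint ({a.1, b.1, c.1} : Finset V) {x.1, y.1, z.1})
    (hn : l + 6 ≤ #H.verts) (hθ : 2 * l * (l + 5) ≤ θ * #H.verts)
    (h : θ * (#H.verts : ℝ) ^ l ≤ ((innerWalks (edgeRel H) a b c x y z l).ncard : ℝ)) :
    θ / 2 * (#H.verts : ℝ) ^ l ≤ ((H.connectingPaths a.1 b.1 c.1 x.1 y.1 z.1 l).ncard : ℝ) := by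
  have hcard : Nat.card H.verts = #H.verts := by rw [Nat.card_eq_fintype_card, Fintype.card_coe]
  rw [← hcard] at hn hθ h ⊢
  have h1 := half_le_ncard_nodup (fun q hq => hq.1) ({a, b, c, x, y, z} : Finset H.verts)
    Finset.card_le_six hn hθ h
  refine h1.trans (Nat.cast_le.2 ?_)
  refine Set.ncard_le_ncard_of_injOn (List.map Subtype.val) ?_
    (List.map_injective_iff.2 Subtype.val_injective).injOn (finite_connectingPaths ..)
  rintro q ⟨⟨hl, hT⟩, hnd, hav⟩
  have hmap : [a.1, b.1, c.1] ++ q.map Subtype.val ++ [x.1, y.1, z.1] =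
      ([a, b, c] ++ q ++ [x, y, z]).map Subtype.val := by simp
  refine ⟨by simpa using hl, ?_, ?_, ?_⟩
  · simp only [Finset.mem_insert, Finset.mem_singleton, not_or] at hav
    refine List.nodup_append'.2 ⟨List.nodup_append'.2 ⟨ConnTriple.nodup hζ habc,
      hnd.map Subtype.val_injective, ?_⟩, ConnTriple.nodup hζ hxyz, ?_⟩
    · intro v hv hv'
      obtain ⟨w, hw, rfl⟩ := List.mem_map.1 hv'
      obtain ⟨h1, h2, h3, -⟩ := hav w hw
      simp only [List.mem_cons, List.not_mem_nil, or_false, ← Subtype.ext_iff] at hv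
      tauto
    · intro v hv hv'
      rcases List.mem_append.1 hv with hv | hv
      · exact Finset.disjoint_left.1 hdisj (by simpa using hv) (by simpa using hv')
      · obtain ⟨w, hw, rfl⟩ := List.mem_map.1 hv
        obtain ⟨-, -, -, h1, h2, h3⟩ := hav w hw
        simp only [List.mem_cons, List.not_mem_nil, or_false, ← Subtype.ext_iff] at hv'
        tauto
  · rw [hmap]
    intro v hv
    obtain ⟨w, -, rfl⟩ := List.mem_map.1 hv
    exact w.2
  · rw [hmap]
    exact fun t ht h4 => tight_edgeRel_infix hT ht h4

/-- Connecting constants exist for any `ζ > 0`, for the number of inner vertices of a walk that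
passes through `j` intermediate triples. -/
theorem exists_half_connect {α β : ℝ} (m : ℕ) (hα : 0 < α) (hα' : α < 1 / 3) (hβ : 0 < β) {ζ : ℝ}
    (hζ : 0 < ζ) (j : ℕ) :
    ∃ θ : ℝ, 0 < θ ∧ ∃ n₀ : ℕ, ∀ (V : Type u) [DecidableEq V] (H : UniformHypergraph V 4)
      (R : ∀ p : Sym2 V, (H.pairLink p).Subgraph),
      n₀ ≤ #H.verts → IsFourUniformSetup α β (2 * m + 1) H R →
        ∀ a b c x y z : V,
          H.IsConnectableTriple R ζ a b c → H.IsConnectableTriple R ζ x y z →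
          Disjoint ({a, b, c} : Finset V) {x, y, z} →
            θ * H.order ^ (j * (12 * m + 13) + (12 * m + 10)) ≤
              ((H.connectingPaths a b c x y z
                (j * (12 * m + 13) + (12 * m + 10))).ncard : ℝ) := by
  have hζ' : 0 < min (ζ / 2) (1 / 24) := lt_min (by positivity) (by norm_num)
  obtain ⟨θ, hθ, hconn⟩ := exists_connect.{u} (β := β * (2 / 3) ^ (2 * m)) m hα (by positivity)
    (by norm_num : (0 : ℝ) < 1 / 24) hζ' (min_le_right _ _) j
  generalize j * (12 * m + 13) + (12 * m + 10) = l at hconn ⊢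
  have hlarge : ∀ᶠ n : ℕ in Filter.atTop, 4 ≤ n ∧ l + 6 ≤ n ∧ 4 ≤ α * n ∧
      2 ≤ min (ζ / 2) (1 / 24) * n ∧ 2 * l * (l + 5) ≤ θ * n := by
    have hlin : ∀ c C : ℝ, 0 < c → ∀ᶠ n : ℕ in Filter.atTop, C ≤ c * n := fun c C hc =>
      (tendsto_natCast_atTop_atTop.const_mul_atTop hc).eventually_ge_atTop C
    filter_upwards [Filter.eventually_ge_atTop 4, Filter.eventually_ge_atTop (l + 6),
      hlin α 4 hα, hlin _ 2 hζ', hlin θ (2 * l * (l + 5)) hθ] with n h1 h2 h3 h4 h5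
    exact ⟨h1, h2, h3, h4, h5⟩
  obtain ⟨n₀, hn₀⟩ := Filter.eventually_atTop.1 hlarge
  refine ⟨θ / 2, by positivity, n₀, ?_⟩
  intro V _ H R hn hset a b c x y z habc hxyz hdisj
  obtain ⟨h4, hl6, hNα, hNζ, hNθ⟩ := hn₀ _ hn
  have hcard : Nat.card H.verts = #H.verts := by rw [Nat.card_eq_fintype_card, Fintype.card_coe]
  have h1 := (connTriple_of_isConnectableTriple hζ (by omega) habc).mono (min_le_left _ (1 / 24))
  have h2 := (connTriple_of_isConnectableTriple hζ (by omega) hxyz).mono (min_le_left _ (1 / 24))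
  have h3 := hconn H.verts (edgeRel H) (adjRel H R) (hset.isLinkSystem hα hα' hβ h4)
    (by rwa [hcard]) (by rwa [hcard]) _ _ _ _ _ _ h1 h2
  rw [hcard] at h3
  have h5 := half_le_ncard_connectingPaths hζ' h1 h2 hdisj hl6 hNθ h3
  unfold UniformHypergraph.order
  exact h5

end ConnectingPaths

/-- The numbers of inner vertices of the walks through `1`, `2`, `3` and `0` intermediate triples
form a length system. -/
theorem isLengthSystem (m : ℕ) (hm : 1 ≤ m) :
    IsLengthSystem (2 * m + 1) (fun i => (i + 2) % 4 * (12 * m + 13) + (12 * m + 10)) := by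
  intro i hi
  rw [Finset.mem_Icc] at hi
  obtain ⟨h1, h4⟩ := hi
  unfold Nat.ModEq
  interval_cases i <;> norm_num <;> omega

/-- The minimum of the constants for the four lengths serves all of them. -/
theorem exists_isConnectingConstant {α β : ℝ} (m : ℕ) (hα : 0 < α) (hα' : α < 1 / 3)
    (hβ : 0 < β) {ζ : ℝ} (hζ : 0 < ζ) :
    ∃ θ : ℝ, IsConnectingConstant.{u} α β (2 * m + 1)
      (fun i => (i + 2) % 4 * (12 * m + 13) + (12 * m + 10)) ζ θ := by
  choose θ hθ n₀ h using exists_half_connect.{u} m hα hα' hβ hζ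
  have hmin : ∀ j ∈ Finset.range 4, min 1 ((Finset.range 4).inf' ⟨0, by simp⟩ θ) ≤ θ j :=
    fun j hj => (min_le_right _ _).trans (Finset.inf'_le _ hj)
  refine ⟨min 1 ((Finset.range 4).inf' ⟨0, by simp⟩ θ), lt_min one_pos
    ((Finset.lt_inf'_iff _).2 fun j _ => hθ j), min_le_left _ _, (Finset.range 4).sup n₀, ?_⟩
  intro V _ H R hn hset a b c x y z habc hxyz hdisj i _
  have hi : (i + 2) % 4 ∈ Finset.range 4 := Finset.mem_range.2 (Nat.mod_lt _ (by norm_num))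
  refine le_trans (mul_le_mul_of_nonneg_right (hmin _ hi) ?_)
    (h ((i + 2) % 4) V H R ((Finset.le_sup hi).trans hn) hset a b c x y z habc hxyz hdisj)
  exact pow_nonneg (Nat.cast_nonneg _) _

/-! ### Simultaneous rounding -/

section Rounding

/-- A bound for the moment generating function of a two-point distribution. -/
theorem two_point_exp_le {a p q t : ℝ} (ha0 : 0 ≤ a) (ha1 : a ≤ 1) (ht0 : 0 ≤ t) (ht1 : t ≤ 1)
    (hpq : |q - p| ≤ 1) :
    (1 - a) * Real.exp (t * p) + a * Real.exp (t * q) ≤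
      Real.exp (t ^ 2) * Real.exp (t * ((1 - a) * p + a * q)) := by
  set D := t * (q - p) with hD
  have hDt : |D| ≤ t := by
    rw [hD, abs_mul, abs_of_nonneg ht0]
    exact mul_le_of_le_one_right ht0 hpq
  have hD1 := abs_le.1 (hDt.trans ht1)
  have hDsq : D ^ 2 ≤ t ^ 2 := by rw [← sq_abs D]; exact pow_le_pow_left₀ (abs_nonneg _) hDt 2
  have h1 : Real.exp (-a * D) ≤ 1 + -a * D + (-a * D) ^ 2 := by
    have h := Real.abs_exp_sub_one_sub_id_le (x := -a * D) (by
      rw [abs_mul, abs_neg, abs_of_nonneg ha0]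
      exact mul_le_one₀ ha1 (abs_nonneg _) (hDt.trans ht1))
    linarith [(abs_le.1 h).2]
  have h2 : Real.exp ((1 - a) * D) ≤ 1 + (1 - a) * D + ((1 - a) * D) ^ 2 := by
    have h := Real.abs_exp_sub_one_sub_id_le (x := (1 - a) * D) (by
      rw [abs_mul, abs_of_nonneg (by linarith)]
      exact mul_le_one₀ (by linarith) (abs_nonneg _) (hDt.trans ht1))
    linarith [(abs_le.1 h).2]
  have h3 : (1 - a) * Real.exp (-a * D) + a * Real.exp ((1 - a) * D) ≤ Real.exp (t ^ 2) := by
    have h4 := mul_le_mul_of_nonneg_left h1 (by linarith : 0 ≤ 1 - a)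
    have h5 := mul_le_mul_of_nonneg_left h2 ha0
    have h6 : a * (1 - a) * D ^ 2 ≤ 1 * D ^ 2 :=
      mul_le_mul_of_nonneg_right (by nlinarith) (sq_nonneg D)
    have h7 := Real.add_one_le_exp (t ^ 2)
    calc _ ≤ 1 + a * (1 - a) * D ^ 2 := by linarith
      _ ≤ _ := by linarith
  have h4 : Real.exp (t * p) =
      Real.exp (-a * D) * Real.exp (t * ((1 - a) * p + a * q)) := by
    rw [← Real.exp_add, hD]; congr 1; ring
  have h5 : Real.exp (t * q) =
      Real.exp ((1 - a) * D) * Real.exp (t * ((1 - a) * p + a * q)) := by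
    rw [← Real.exp_add, hD]; congr 1; ring
  rw [h4, h5, ← mul_assoc (1 - a), ← mul_assoc a, ← add_mul]
  exact mul_le_mul_of_nonneg_right h3 (Real.exp_pos _).le

theorem prod_update_of_mem {W : Type*} [DecidableEq W] {F : Finset W} (x : W → ℝ) {v : W}
    (hv : v ∈ F) (c : ℝ) :
    ∏ w ∈ F, Function.update x v c w = c * ∏ w ∈ F.erase v, x w := by
  rw [← Finset.mul_prod_erase F _ hv, Function.update_self]
  congr 1
  exact Finset.prod_congr rfl fun w hw => Function.update_of_ne (Finset.ne_of_mem_erase hw) _ _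

theorem prod_update_of_notMem {W : Type*} [DecidableEq W] {F : Finset W} (x : W → ℝ) {v : W}
    (hv : v ∉ F) (c : ℝ) : ∏ w ∈ F, Function.update x v c w = ∏ w ∈ F, x w :=
  Finset.prod_congr rfl fun w hw => Function.update_of_ne (fun h => hv (by rwa [← h])) _ _

theorem prod_eq_update {W : Type*} [DecidableEq W] (F : Finset W) (x : W → ℝ) (v : W) :
    ∏ w ∈ F, x w = (1 - x v) * ∏ w ∈ F, Function.update x v 0 w +
      x v * ∏ w ∈ F, Function.update x v 1 w := by
  by_cases hv : v ∈ F
  · rw [prod_update_of_mem x hv, prod_update_of_mem x hv, ← Finset.mul_prod_erase F _ hv]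
    ring
  · rw [prod_update_of_notMem x hv, prod_update_of_notMem x hv]
    ring

theorem abs_prod_update_sub_le {W : Type*} [DecidableEq W] (F : Finset W) {x : W → ℝ}
    (hx : ∀ w, 0 ≤ x w ∧ x w ≤ 1) (v : W) :
    |∏ w ∈ F, Function.update x v 1 w - ∏ w ∈ F, Function.update x v 0 w| ≤
      if v ∈ F then 1 else 0 := by
  split_ifs with hv
  · rw [prod_update_of_mem x hv, prod_update_of_mem x hv, one_mul, zero_mul, sub_zero,
      abs_of_nonneg (Finset.prod_nonneg fun w _ => (hx w).1)]
    exact Finset.prod_le_one (fun w _ => (hx w).1) fun w _ => (hx w).2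
  · rw [prod_update_of_notMem x hv, prod_update_of_notMem x hv, sub_self, abs_zero]

/-- Coordinatewise rounding with an exponential potential: functions that are affine and
`1`-Lipschitz in each coordinate can be rounded simultaneously at a small loss. -/
theorem exists_rounding_on {W J : Type*} [DecidableEq W] [Fintype J]
    {f : J → (W → ℝ) → ℝ}
    (haff : ∀ j x v, f j x =
      (1 - x v) * f j (Function.update x v 0) + x v * f j (Function.update x v 1))
    (hlip : ∀ j x v, (∀ w, 0 ≤ x w ∧ x w ≤ 1) →
      |f j (Function.update x v 1) - f j (Function.update x v 0)| ≤ 1)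
    {t : ℝ} (ht0 : 0 ≤ t) (ht1 : t ≤ 1) {x : W → ℝ} (hx : ∀ w, 0 ≤ x w ∧ x w ≤ 1)
    (T : Finset W) :
    ∃ y : W → ℝ, (∀ w, 0 ≤ y w ∧ y w ≤ 1) ∧ (∀ w ∈ T, y w = 0 ∨ y w = 1) ∧
      ∑ j, Real.exp (t * f j y) ≤ Real.exp (t ^ 2 * #T) * ∑ j, Real.exp (t * f j x) := by
  induction T using Finset.induction_on with
  | empty => exact ⟨x, hx, by simp, by simp⟩
  | insert v T hv ih =>
    obtain ⟨y, hy, hyT, hsum⟩ := ih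
    have hupd : ∀ c : ℝ, (c = 0 ∨ c = 1) → (∀ w, 0 ≤ Function.update y v c w ∧
        Function.update y v c w ≤ 1) ∧ ∀ w ∈ insert v T, Function.update y v c w = 0 ∨
          Function.update y v c w = 1 := by
      intro c hc
      refine ⟨fun w => ?_, fun w hw => ?_⟩
      · rcases eq_or_ne w v with rfl | hwv
        · rw [Function.update_self]
          rcases hc with rfl | rfl <;> norm_num
        · rw [Function.update_of_ne hwv]
          exact hy w
      · rcases eq_or_ne w v with rfl | hwv
        · rwa [Function.update_self]
        · rw [Function.update_of_ne hwv]
          exact hyT w (Finset.mem_of_mem_insert_of_ne hw hwv)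
    have hkey : (1 - y v) * ∑ j, Real.exp (t * f j (Function.update y v 0)) +
        y v * ∑ j, Real.exp (t * f j (Function.update y v 1)) ≤
        Real.exp (t ^ 2) * ∑ j, Real.exp (t * f j y) := by
      rw [Finset.mul_sum, Finset.mul_sum, Finset.mul_sum, ← Finset.sum_add_distrib]
      refine Finset.sum_le_sum fun j _ => ?_
      rw [haff j y v]
      exact two_point_exp_le (hy v).1 (hy v).2 ht0 ht1 (hlip j y v hy)
    have hbound : Real.exp (t ^ 2) * ∑ j, Real.exp (t * f j y) ≤
        Real.exp (t ^ 2 * #(insert v T)) * ∑ j, Real.exp (t * f j x) := by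
      rw [Finset.card_insert_of_notMem hv]
      push_cast
      rw [mul_add, mul_one, add_comm, Real.exp_add, mul_assoc]
      exact mul_le_mul_of_nonneg_left hsum (Real.exp_pos _).le
    -- A weighted mean of the two potentials after rounding `y v` is small, hence one of them is.
    by_contra hcon
    push Not at hcon
    have h0 := hcon _ (hupd 0 (Or.inl rfl)).1 (hupd 0 (Or.inl rfl)).2
    have h1 := hcon _ (hupd 1 (Or.inr rfl)).1 (hupd 1 (Or.inr rfl)).2
    have h2 := hkey.trans hbound
    set B := Real.exp (t ^ 2 * #(insert v T)) * ∑ j, Real.exp (t * f j x)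
    rcases (hy v).1.eq_or_lt with h3 | h3
    · rw [← h3] at h2
      linarith
    · nlinarith [mul_lt_mul_of_pos_left h1 h3,
        mul_le_mul_of_nonneg_left h0.le (sub_nonneg.2 (hy v).2)]

/-- Simultaneous rounding of few functions that are affine and `1`-Lipschitz in each coordinate. -/
theorem exists_rounding {W J : Type*} [Fintype W] [DecidableEq W] [Fintype J]
    {f : J → (W → ℝ) → ℝ}
    (haff : ∀ j x v, f j x =
      (1 - x v) * f j (Function.update x v 0) + x v * f j (Function.update x v 1))
    (hlip : ∀ j x v, (∀ w, 0 ≤ x w ∧ x w ≤ 1) →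
      |f j (Function.update x v 1) - f j (Function.update x v 0)| ≤ 1)
    {δ : ℝ} (hδ0 : 0 < δ) (hδ1 : δ ≤ 1) {x : W → ℝ} (hx : ∀ w, 0 ≤ x w ∧ x w ≤ 1)
    (hJ : (Fintype.card J : ℝ) < Real.exp (δ ^ 2 / 4 * Fintype.card W)) :
    ∃ T : Finset W, ∀ j, f j (fun w => if w ∈ T then 1 else 0) ≤ f j x + δ * Fintype.card W := by
  -- The parameter `δ / 2` of the potential maximizes `t * δ - t ^ 2`.
  obtain ⟨y, -, hyW, hsum⟩ := exists_rounding_on (f := fun j z => f j z - f j x)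
    (fun j z v => by
      have := haff j z v
      linear_combination this)
    (fun j z v hz => by simpa using hlip j z v hz)
    (by positivity : 0 ≤ δ / 2) (by linarith) hx Finset.univ
  have hy : y = fun w => if w ∈ Finset.univ.filter (fun w => y w = 1) then 1 else 0 := by
    funext w
    rcases hyW w (Finset.mem_univ w) with h | h <;> simp [h]
  refine ⟨Finset.univ.filter fun w => y w = 1, fun j => ?_⟩
  rw [← hy]
  have h1 : Real.exp (δ / 2 * (f j y - f j x)) ≤
      ∑ j, Real.exp (δ / 2 * (f j y - f j x)) :=
    Finset.single_le_sum (f := fun j => Real.exp (δ / 2 * (f j y - f j x)))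
      (fun _ _ => (Real.exp_pos _).le) (Finset.mem_univ j)
  have h2 : ∑ j, Real.exp (δ / 2 * (f j x - f j x)) = Fintype.card J := by simp
  have h3 : Real.exp (δ / 2 * (f j y - f j x)) <
      Real.exp (δ / 2 * (δ * Fintype.card W)) := by
    refine (h1.trans hsum).trans_lt ?_
    rw [h2, Finset.card_univ]
    refine (mul_lt_mul_of_pos_left hJ (Real.exp_pos _)).trans_eq ?_
    rw [← Real.exp_add]
    congr 1
    ring
  have h4 := Real.exp_lt_exp.1 h3
  have h5 := lt_of_mul_lt_mul_left h4 (by positivity)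
  linarith

/-- Few lists of a given length contain a given entry. -/
theorem card_mul_card_mem_le {W : Type*} [Fintype W] [DecidableEq W] (Q : Finset (List W)) {m : ℕ}
    (hQ : ∀ q ∈ Q, q.length = m) (v : W) :
    Fintype.card W * #{q ∈ Q | v ∈ q} ≤ m * Fintype.card W ^ m := by
  rcases m with _ | m
  · have : {q ∈ Q | v ∈ q} = ∅ := by
      refine Finset.filter_eq_empty_iff.2 fun q hq => ?_
      rw [List.length_eq_zero_iff.1 (hQ q hq)]
      simp
    simp [this]
  have h1 : #{q ∈ Q | v ∈ q} ≤ (m + 1) * Fintype.card W ^ m := by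
    have hcard : Nat.card (Fin (m + 1) × {q : List W | q.length = m}) =
        (m + 1) * Fintype.card W ^ m := by
      rw [Nat.card_prod, Nat.card_fin, Nat.card_coe_set_eq, ncard_setOf_length_eq,
        Nat.card_eq_fintype_card]
    have : Finite {q : List W | q.length = m} := List.finite_length_eq W m
    rw [← hcard, ← Fintype.card_coe, ← Nat.card_eq_fintype_card]
    have hlt : ∀ q : {q // q ∈ ({q ∈ Q | v ∈ q} : Finset (List W))}, q.1.idxOf v < m + 1 := by
      intro q
      obtain ⟨hq, hvq⟩ := Finset.mem_filter.1 q.2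
      rw [← hQ q hq]
      exact List.idxOf_lt_length_iff.2 hvq
    refine Nat.card_le_card_of_injective (fun q => (⟨q.1.idxOf v, hlt q⟩,
      ⟨q.1.take (q.1.idxOf v) ++ q.1.drop (q.1.idxOf v + 1), ?_⟩)) ?_
    · have := hlt q
      have := hQ q (Finset.mem_filter.1 q.2).1
      simp only [Set.mem_ofPred_eq, List.length_append, List.length_take, List.length_drop]
      omega
    · intro q q' h
      simp only [Prod.mk.injEq, Fin.mk.injEq, Subtype.mk.injEq] at h
      obtain ⟨hi, hl⟩ := h
      have hq := hQ q (Finset.mem_filter.1 q.2).1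
      have hq' := hQ q' (Finset.mem_filter.1 q'.2).1
      have hlt1 := hlt q
      have hlt2 := hlt q'
      obtain ⟨h3, h4⟩ := List.append_inj hl (by
        rw [List.length_take, List.length_take]; omega)
      have hdec : ∀ q : {q // q ∈ ({q ∈ Q | v ∈ q} : Finset (List W))},
          q.1 = q.1.take (q.1.idxOf v) ++ v :: q.1.drop (q.1.idxOf v + 1) := by
        intro q
        have h5 : q.1.idxOf v < q.1.length :=
          List.idxOf_lt_length_iff.2 (Finset.mem_filter.1 q.2).2
        conv_lhs => rw [← List.take_append_drop (q.1.idxOf v) q.1, List.drop_eq_getElem_cons h5]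
        rw [List.getElem_idxOf]
      refine Subtype.ext ?_
      rw [hdec q, hdec q', h3, h4]
  calc _ ≤ Fintype.card W * ((m + 1) * Fintype.card W ^ m) := Nat.mul_le_mul_left _ h1
    _ = _ := by ring

end Rounding

/-! ### Random subsets and families of lists -/

section Reservoir

variable {W ι : Type*} [DecidableEq W]

/-- The polynomial that counts, at the indicator function of a set `T`, the lists in `Q` all of
whose entries belong to `T`. -/
noncomputable def listPoly (Q : Finset (List W)) (x : W → ℝ) : ℝ :=
  ∑ q ∈ Q, ∏ w ∈ q.toFinset, x w

theorem listPoly_eq_update (Q : Finset (List W)) (x : W → ℝ) (v : W) :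
    listPoly Q x = (1 - x v) * listPoly Q (Function.update x v 0) +
      x v * listPoly Q (Function.update x v 1) := by
  unfold listPoly
  rw [Finset.mul_sum, Finset.mul_sum, ← Finset.sum_add_distrib]
  exact Finset.sum_congr rfl fun q _ => prod_eq_update _ x v

theorem abs_listPoly_update_sub_le (Q : Finset (List W)) {x : W → ℝ}
    (hx : ∀ w, 0 ≤ x w ∧ x w ≤ 1) (v : W) :
    |listPoly Q (Function.update x v 1) - listPoly Q (Function.update x v 0)| ≤
      #{q ∈ Q | v ∈ q} := by
  unfold listPoly
  rw [← Finset.sum_sub_distrib]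
  refine (Finset.abs_sum_le_sum_abs _ _).trans ?_
  refine (Finset.sum_le_sum fun q _ => abs_prod_update_sub_le _ hx v).trans (le_of_eq ?_)
  simp

theorem listPoly_const {Q : Finset (List W)} {m : ℕ} (hQ : ∀ q ∈ Q, q.length = m ∧ q.Nodup)
    (p : ℝ) : listPoly Q (fun _ => p) = p ^ m * #Q := by
  unfold listPoly
  rw [Finset.sum_congr rfl fun q hq => by
    rw [Finset.prod_const, List.toFinset_card_of_nodup (hQ q hq).2, (hQ q hq).1]]
  rw [Finset.sum_const, nsmul_eq_mul, mul_comm]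

theorem listPoly_indicator [Fintype W] (Q : Finset (List W)) (T : Finset W) :
    listPoly Q (fun w => if w ∈ T then 1 else 0) = #{q ∈ Q | ∀ w ∈ q, w ∈ T} := by
  unfold listPoly
  rw [Finset.card_filter, Nat.cast_sum]
  refine Finset.sum_congr rfl fun q _ => ?_
  rw [Finset.prod_boole]
  simp

/-- A set of vertices of prescribed density that contains, for few families of lists, almost the
expected number of their members. -/
theorem exists_reservoir [Fintype W] [Fintype ι] {Q : ι → Finset (List W)} {l : ι → ℕ} {M : ℕ} (hM : 0 < M)
    (hl : ∀ i, l i ≤ M) (hQ : ∀ i, ∀ q ∈ Q i, q.length = l i ∧ q.Nodup) {p δ : ℝ} (hp0 : 0 ≤ p)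
    (hp1 : p ≤ 1) (hδ0 : 0 < δ) (hδ1 : δ ≤ 1)
    (hι : (Fintype.card ι + 2 : ℝ) < Real.exp (δ ^ 2 / 4 * Fintype.card W)) :
    ∃ T : Finset W, (p - δ) * Fintype.card W ≤ #T ∧ (#T : ℝ) ≤ (p + δ) * Fintype.card W ∧
      ∀ i, p ^ l i * #(Q i) - δ * M * (Fintype.card W : ℝ) ^ l i ≤
        #{q ∈ Q i | ∀ w ∈ q, w ∈ T} := by
  rcases isEmpty_or_nonempty W with hW | hW
  · have h0 : Fintype.card W = 0 := Fintype.card_eq_zero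
    rw [h0] at hι
    simp only [Nat.cast_zero, mul_zero, Real.exp_zero] at hι
    linarith [(Nat.cast_nonneg (Fintype.card ι) : (0 : ℝ) ≤ Fintype.card ι)]
  set n : ℝ := (Fintype.card W : ℝ) with hn
  have hn0 : 0 < n := by
    rw [hn]
    exact_mod_cast Fintype.card_pos
  have hM' : (0 : ℝ) < M := by exact_mod_cast hM
  -- The size of the set is controlled by the lists with a single entry.
  let Q₁ : Finset (List W) := Finset.univ.image fun w => [w]
  have hQ₁ : ∀ q ∈ Q₁, q.length = 1 ∧ q.Nodup := by
    intro q hq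
    obtain ⟨w, -, rfl⟩ := Finset.mem_image.1 hq
    simp
  have hQ₁card : #Q₁ = Fintype.card W := by
    rw [Finset.card_image_of_injective _ (fun a b h => by simpa using h), Finset.card_univ]
  have hQ₁T : ∀ T : Finset W, #{q ∈ Q₁ | ∀ w ∈ q, w ∈ T} = #T := by
    intro T
    rw [Finset.filter_image, Finset.card_image_of_injective _ (fun a b h => by simpa using h)]
    congr 1
    ext w
    simp
  -- Every list polynomial is scaled so that it becomes `1`-Lipschitz in each coordinate.
  let f : ι ⊕ Bool → (W → ℝ) → ℝ := fun j x => Sum.elim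
    (fun i => -(n / (M * n ^ l i)) * listPoly (Q i) x)
    (fun b => (if b then 1 else -1) * listPoly Q₁ x) j
  have hlip₁ : ∀ (x : W → ℝ) (v : W), (∀ w, 0 ≤ x w ∧ x w ≤ 1) →
      |listPoly Q₁ (Function.update x v 1) - listPoly Q₁ (Function.update x v 0)| ≤ 1 := by
    intro x v hx
    have h1 : n * #{q ∈ Q₁ | v ∈ q} ≤ n := by
      have := card_mul_card_mem_le Q₁ (fun q hq => (hQ₁ q hq).1) v
      rw [one_mul, pow_one] at this
      rw [hn]
      exact_mod_cast this
    have h2 : (#{q ∈ Q₁ | v ∈ q} : ℝ) ≤ 1 := by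
      refine le_of_mul_le_mul_left ?_ hn0
      rwa [mul_one]
    exact (abs_listPoly_update_sub_le Q₁ hx v).trans h2
  obtain ⟨T, hT⟩ := exists_rounding (f := f) (x := fun _ => p) (δ := δ)
    (by
      rintro (i | b) x v
      · simp only [f, Sum.elim_inl]
        rw [listPoly_eq_update (Q i) x v]
        ring
      · simp only [f, Sum.elim_inr]
        rw [listPoly_eq_update Q₁ x v]
        ring)
    (by
      rintro (i | b) x v hx
      · simp only [f, Sum.elim_inl]
        rw [← mul_sub, abs_mul, abs_neg, abs_of_nonneg (by positivity), div_mul_eq_mul_div,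
          div_le_one (by positivity)]
        have h1 := mul_le_mul_of_nonneg_left (abs_listPoly_update_sub_le (Q i) hx v) hn0.le
        have h2 : n * #{q ∈ Q i | v ∈ q} ≤ l i * n ^ l i := by
          have := card_mul_card_mem_le (Q i) (fun q hq => (hQ i q hq).1) v
          rw [hn]
          exact_mod_cast this
        have h3 : (l i : ℝ) ≤ M := by exact_mod_cast hl i
        exact (h1.trans h2).trans (mul_le_mul_of_nonneg_right h3 (by positivity))
      · simp only [f, Sum.elim_inr]
        rw [← mul_sub, abs_mul]
        have h1 : |(if b then 1 else -1 : ℝ)| = 1 := by cases b <;> simp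
        rw [h1, one_mul]
        exact hlip₁ x v hx)
    hδ0 hδ1 (fun _ => ⟨hp0, hp1⟩) (by simpa using hι)
  refine ⟨T, ?_, ?_, fun i => ?_⟩
  · have h1 := hT (Sum.inr false)
    simp only [f, Sum.elim_inr, Bool.false_eq_true, if_false] at h1
    rw [listPoly_indicator, listPoly_const hQ₁, hQ₁card, hQ₁T] at h1
    linarith
  · have h1 := hT (Sum.inr true)
    simp only [f, Sum.elim_inr, if_true] at h1
    rw [listPoly_indicator, listPoly_const hQ₁, hQ₁card, hQ₁T] at h1
    linarith
  · have h1 := hT (Sum.inl i)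
    simp only [f, Sum.elim_inl] at h1
    rw [listPoly_indicator, listPoly_const (hQ i)] at h1
    set k : ℝ := (#{q ∈ Q i | ∀ w ∈ q, w ∈ T} : ℝ)
    have hc : 0 < n / (M * n ^ l i) := by positivity
    have h2 : n / (M * n ^ l i) * (p ^ l i * #(Q i) - δ * M * n ^ l i) ≤
        n / (M * n ^ l i) * k := by
      have h3 : n / (M * n ^ l i) * (δ * M * n ^ l i) = δ * n := by field_simp
      rw [mul_sub, h3]
      linarith
    exact le_of_mul_le_mul_left h2 hc

end Reservoir

/-! ### The reservoir -/

section Choice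

/-- A loss `δ` so small that `θ p ^ l`, reduced by `δ M`, still exceeds half of `θ (p + δ) ^ l`. -/
theorem exists_small_loss {θ p ε : ℝ} (hθ : 0 < θ) (hp : 0 < p) (hε : 0 < ε) (M : ℕ) :
    ∃ δ : ℝ, 0 < δ ∧ δ ≤ ε ∧ ∀ l ≤ M, θ * (p + δ) ^ l / 2 ≤ θ * p ^ l - δ * M := by
  have hpow : ∀ l ∈ Finset.range (M + 1), ∀ᶠ δ : ℝ in nhds 0,
      θ * (p + δ) ^ l / 2 < θ * p ^ l - δ * M := by
    intro l _
    have hcont : ContinuousAt (fun δ : ℝ => θ * p ^ l - δ * M - θ * (p + δ) ^ l / 2) 0 := by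
      fun_prop
    have hpos : 0 < θ * p ^ l - 0 * M - θ * (p + 0) ^ l / 2 := by
      rw [zero_mul, sub_zero, add_zero]
      have : 0 < θ * p ^ l := by positivity
      linarith
    filter_upwards [hcont.eventually (lt_mem_nhds hpos)] with δ hδ
    linarith
  have hall := ((Filter.eventually_all_finset _).2 hpow).filter_mono
    (nhdsWithin_le_nhds (s := Set.Ioi (0 : ℝ)))
  have hsmall : ∀ᶠ δ : ℝ in nhdsWithin 0 (Set.Ioi 0), δ ∈ Set.Ioo 0 ε :=
    Ioo_mem_nhdsGT hε
  obtain ⟨δ, h1, h2⟩ := (hall.and hsmall).exists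
  exact ⟨δ, h2.1, h2.2.le, fun l hl => (h1 l (Finset.mem_range.2 (by omega))).le⟩

theorem eventually_pow_lt_exp {c : ℝ} (hc : 0 < c) :
    ∀ᶠ n : ℕ in Filter.atTop, 5 * (n : ℝ) ^ 6 + 2 < Real.exp (c * n) := by
  have h := (isLittleO_pow_exp_pos_mul_atTop 6 hc).bound (show (0 : ℝ) < 1 / 14 by norm_num)
  filter_upwards [tendsto_natCast_atTop_atTop.eventually h, Filter.eventually_ge_atTop 1]
    with n hn h1
  rw [Real.norm_eq_abs, Real.norm_eq_abs, abs_of_nonneg (by positivity),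
    abs_of_pos (Real.exp_pos _)] at hn
  have h2 : (1 : ℝ) ≤ (n : ℝ) ^ 6 := one_le_pow₀ (by exact_mod_cast h1)
  linarith [Real.exp_pos (c * n)]

end Choice

/-- The reservoir: a random subset of the vertices of density `3 / 4 * θ₁ ^ 2` has the required
size and contains the expected proportion of the connecting paths, up to a small loss. -/
theorem exists_reservoir_of_isConnectingConstant {α β : ℝ} {ℓ : ℕ} {L : ℕ → ℕ} {ζ₁ ζ₂ θ₁ θ₂ : ℝ}
    (hℓ : 0 < ℓ) (hL : IsLengthSystem ℓ L) (h₁ : IsConnectingConstant.{u} α β ℓ L ζ₁ θ₁)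
    (h₂ : IsConnectingConstant.{u} α β ℓ L ζ₂ θ₂) :
    ∃ n₀ : ℕ, ∀ (V : Type u) [DecidableEq V] (H : UniformHypergraph V 4)
      (R : ∀ p : Sym2 V, (H.pairLink p).Subgraph),
      n₀ ≤ #H.verts → IsFourUniformSetup α β ℓ H R →
      ∃ 𝓡 : Finset V, 𝓡 ⊆ H.verts ∧
        θ₁ ^ 2 * H.order / 2 ≤ (#𝓡 : ℝ) ∧ (#𝓡 : ℝ) ≤ θ₁ ^ 2 * H.order ∧
        ∀ a b c x y z : V,
          H.IsConnectableTriple R ζ₂ a b c → H.IsConnectableTriple R ζ₂ x y z →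
          Disjoint ({a, b, c} : Finset V) {x, y, z} →
          ∀ i ∈ Finset.Icc 1 4,
            θ₂ * (#𝓡 : ℝ) ^ L i / 2 ≤
              ({q | q ∈ H.connectingPaths a b c x y z (L i) ∧ ∀ v ∈ q, v ∈ 𝓡}.ncard : ℝ) := by
  obtain ⟨hθ₁, hθ₁', -⟩ := h₁
  obtain ⟨hθ₂, -, n₂, hconn⟩ := h₂
  have hsq : 0 < θ₁ ^ 2 := by positivity
  have hsq' : θ₁ ^ 2 ≤ 1 := pow_le_one₀ hθ₁.le hθ₁'
  obtain ⟨δ, hδ0, hδ, hloss⟩ := exists_small_loss hθ₂ (p := 3 / 4 * θ₁ ^ 2) (ε := θ₁ ^ 2 / 4)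
    (by positivity) (by positivity) (50 * ℓ)
  obtain ⟨n₁, hn₁⟩ := Filter.eventually_atTop.1
    (eventually_pow_lt_exp (c := δ ^ 2 / 4) (by positivity))
  refine ⟨max n₁ n₂, ?_⟩
  intro V _ H R hn hset
  have hcard : Fintype.card H.verts = #H.verts := Fintype.card_coe _
  have hfin : ∀ (a b c x y z : V) (i : ℕ), {q : List H.verts | q.length = min (L i) (50 * ℓ) ∧
      q.map Subtype.val ∈ H.connectingPaths a b c x y z (L i)}.Finite :=
    fun a b c x y z i => (List.finite_length_eq H.verts _).subset fun q hq => hq.1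
  -- The lengths are capped so that they are bounded for the index `0` as well.
  let ι := (H.verts × H.verts × H.verts × H.verts × H.verts × H.verts) × Fin 5
  let Q : ι → Finset (List H.verts) := fun t =>
    (hfin t.1.1 t.1.2.1 t.1.2.2.1 t.1.2.2.2.1 t.1.2.2.2.2.1 t.1.2.2.2.2.2 t.2).toFinset
  obtain ⟨T, hT1, hT2, hT⟩ := exists_reservoir (Q := Q) (l := fun t => min (L t.2) (50 * ℓ))
    (M := 50 * ℓ) (by positivity) (fun t => min_le_right _ _)
    (by
      intro t q hq
      obtain ⟨h1, h2⟩ := (Set.Finite.mem_toFinset _).1 hq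
      refine ⟨h1, List.Nodup.of_map Subtype.val ?_⟩
      exact (List.nodup_append.1 (List.nodup_append.1 h2.2.1).1).2.1)
    (p := 3 / 4 * θ₁ ^ 2) (by positivity) (by linarith) hδ0 (by linarith)
    (by
      have h1 := hn₁ #H.verts ((le_max_left _ _).trans hn)
      simp only [ι, Fintype.card_prod, hcard, Fintype.card_fin]
      push_cast
      refine lt_of_eq_of_lt ?_ h1
      ring)
  rw [hcard] at hT1 hT2
  have hn0 : (0 : ℝ) ≤ #H.verts := Nat.cast_nonneg _
  refine ⟨T.map (Function.Embedding.subtype _), ?_, ?_, ?_, ?_⟩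
  · intro v hv
    obtain ⟨w, -, rfl⟩ := Finset.mem_map.1 hv
    exact w.2
  · rw [Finset.card_map]
    refine le_trans ?_ hT1
    rw [mul_div_right_comm]
    exact mul_le_mul_of_nonneg_right (by linarith) hn0
  · rw [Finset.card_map]
    refine hT2.trans ?_
    exact mul_le_mul_of_nonneg_right (by linarith) hn0
  · intro a b c x y z habc hxyz hdisj i hi
    have hpaths := hconn V H R ((le_max_right _ _).trans hn) hset a b c x y z habc hxyz hdisj i hi
    obtain ⟨hLi, -⟩ := hL i hi
    have hi5 : i < 5 := by
      have := (Finset.mem_Icc.1 hi).2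
      omega
    have hmin : min (L i) (50 * ℓ) = L i := min_eq_left hLi
    let t : ι := ((⟨a, habc.1⟩, ⟨b, habc.2.1⟩, ⟨c, habc.2.2.1⟩, ⟨x, hxyz.1⟩, ⟨y, hxyz.2.1⟩,
      ⟨z, hxyz.2.2.1⟩), ⟨i, hi5⟩)
    have hTt := hT t
    change _ ^ min (L i) (50 * ℓ) * _ - _ * _ ^ min (L i) (50 * ℓ) ≤ _ at hTt
    rw [hmin, hcard] at hTt
    have hQ : (H.connectingPaths a b c x y z (L i)).ncard ≤ #(Q t) := by
      rw [← Set.ncard_coe_finset]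
      refine (Set.ncard_le_ncard (t := List.map Subtype.val '' (Q t : Set (List H.verts))) ?_
        ((Q t).finite_toSet.image _)).trans (Set.ncard_image_le (Q t).finite_toSet)
      intro q hq
      have hv : ∀ v ∈ q, v ∈ H.verts := fun v h => hq.2.2.1 v (by simp [h])
      lift q to List H.verts using hv
      refine ⟨q, (Set.Finite.mem_toFinset _).2 ⟨?_, hq⟩, rfl⟩
      have := hq.1
      rw [List.length_map] at this
      exact this.trans hmin.symm
    have hQT : #{q ∈ Q t | ∀ w ∈ q, w ∈ T} ≤ {q | q ∈ H.connectingPaths a b c x y z (L i) ∧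
        ∀ v ∈ q, v ∈ T.map (Function.Embedding.subtype _)}.ncard := by
      rw [← Set.ncard_coe_finset]
      refine Set.ncard_le_ncard_of_injOn (List.map Subtype.val) ?_
        (List.map_injective_iff.2 Subtype.val_injective).injOn
        ((finite_connectingPaths H a b c x y z (L i)).subset fun q hq => hq.1)
      intro q hq
      obtain ⟨h1, h2⟩ := Finset.mem_filter.1 (Finset.mem_coe.1 hq)
      refine ⟨((Set.Finite.mem_toFinset _).1 h1).2, fun v hv => ?_⟩
      obtain ⟨w, hw, rfl⟩ := List.mem_map.1 hv
      exact Finset.mem_map_of_mem _ (h2 w hw)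
    have h1 : (#T : ℝ) ^ L i ≤ ((3 / 4 * θ₁ ^ 2 + δ) * #H.verts) ^ L i :=
      pow_le_pow_left₀ (Nat.cast_nonneg _) hT2 _
    have h2 : θ₂ * (#H.verts : ℝ) ^ L i ≤ #(Q t) := hpaths.trans (by exact_mod_cast hQ)
    have hp : 0 ≤ (3 / 4 * θ₁ ^ 2) ^ L i := by positivity
    rw [Finset.card_map]
    refine le_trans ?_ (hTt.trans (Nat.cast_le.2 ((le_of_eq (by congr!)).trans hQT)))
    calc θ₂ * (#T : ℝ) ^ L i / 2 ≤ θ₂ * ((3 / 4 * θ₁ ^ 2 + δ) * #H.verts) ^ L i / 2 := by gcongr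
      _ = θ₂ * (3 / 4 * θ₁ ^ 2 + δ) ^ L i / 2 * (#H.verts : ℝ) ^ L i := by rw [mul_pow]; ring
      _ ≤ (θ₂ * (3 / 4 * θ₁ ^ 2) ^ L i - δ * (50 * ℓ : ℕ)) * (#H.verts : ℝ) ^ L i :=
        mul_le_mul_of_nonneg_right (hloss _ hLi) (by positivity)
      _ = (3 / 4 * θ₁ ^ 2) ^ L i * (θ₂ * (#H.verts : ℝ) ^ L i) -
          δ * (50 * ℓ : ℕ) * (#H.verts : ℝ) ^ L i := by ring
      _ ≤ _ := sub_le_sub_right (mul_le_mul_of_nonneg_left h2 hp) _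

theorem mainTheorem6 (α β : ℝ) (ℓ : ℕ) (hα : 0 < α) (hα' : α < 1 / 3) (hβ : 0 < β)
    (hℓ : 3 ≤ ℓ) (hodd : Odd ℓ) :
    (∃ L : ℕ → ℕ, IsLengthSystem ℓ L ∧
      ∀ ζ : ℝ, 0 < ζ → ∃ θ : ℝ, IsConnectingConstant.{u} α β ℓ L ζ θ) ∧
    (∀ (L : ℕ → ℕ) (ζ₁ ζ₂ θ₁ θ₂ : ℝ), IsLengthSystem ℓ L → 0 < ζ₁ → 0 < ζ₂ →
      IsConnectingConstant.{u} α β ℓ L ζ₁ θ₁ → IsConnectingConstant.{u} α β ℓ L ζ₂ θ₂ →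
      ∃ n₀ : ℕ, ∀ (V : Type u) [DecidableEq V] (H : UniformHypergraph V 4)
        (R : ∀ p : Sym2 V, (H.pairLink p).Subgraph),
        n₀ ≤ #H.verts → IsFourUniformSetup α β ℓ H R →
        ∃ 𝓡 : Finset V, 𝓡 ⊆ H.verts ∧
          θ₁ ^ 2 * H.order / 2 ≤ (#𝓡 : ℝ) ∧ (#𝓡 : ℝ) ≤ θ₁ ^ 2 * H.order ∧
          ∀ a b c x y z : V,
            H.IsConnectableTriple R ζ₂ a b c → H.IsConnectableTriple R ζ₂ x y z →
            Disjoint ({a, b, c} : Finset V) {x, y, z} →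
            ∀ i ∈ Finset.Icc 1 4,
              θ₂ * (#𝓡 : ℝ) ^ L i / 2 ≤
                ({q | q ∈ H.connectingPaths a b c x y z (L i) ∧ ∀ v ∈ q, v ∈ 𝓡}.ncard : ℝ)) := by
  obtain ⟨m, rfl⟩ := hodd
  refine ⟨⟨_, isLengthSystem m (by omega), fun ζ hζ =>
    exists_isConnectingConstant m hα hα' hβ hζ⟩, ?_⟩
  intro L ζ₁ ζ₂ θ₁ θ₂ hL _ _ h₁ h₂
  exact exists_reservoir_of_isConnectingConstant (by omega) hL h₁ h₂
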